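/- \textbf{Setting.} A \emph{generalized effect algebra} (GEA) is a set $E$ with an element $0$ and a partial binary operation $\oplus$ such that, for all $d,e,f\in E$: if $e\oplus f$ is defined, so is $f\oplus e$, and they are equal; if $d\oplus(e\oplus f)$ is defined, so is $(d\oplus e)\oplus f$, and they are equal; $e\oplus 0=e$; $d\oplus e=d\oplus f$ implies $e=f$; $e\oplus f=0$ implies $e=f=0$. Write $e\perp f$ if $e\oplus f$ is defined and $e\le f$ if $e\oplus d=f$ for some (unique) $d=:f\ominus e$; this is a partial order. A family in $E$ is \emph{orthogonal} if the orthosum of each finite subfamily is defined; it is \emph{orthosummable}, with \emph{orthosum} $s$, if it is orthogonal and $s$ is the supremum of its finite partial orthosums. $E$ is \emph{Dedekind orthocomplete} if every orthogonal family whose set of finite partial orthosums is bounded above is orthosummable. An element $c$ is \emph{principal} if $e,f\le c$ and $e\perp f$ imply $e\oplus f\le c$. The \emph{exocenter} $\Gamma_{\mathrm{ex}}(E)$ is the set of maps $\pi\colon E\to E$ such that $e\perp f$ implies $\pi e\perp\pi f$ and $\pi(e\oplus f)=\pi e\oplus\pi f$; $\pi\pi e=\pi e$; $\pi e\le e$;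 and $\pi e=e$, $\pi f=0$ imply $e\perp f$. It is a boolean algebra with $\pi\le\xi$ iff $\pi\circ\xi=\pi$, $\pi\wedge\xi=\pi\circ\xi$, $\pi'e=e\ominus\pi e$, least element $0$ (the zero map) and largest element $1$ (the identity map). $E$ is \emph{centrally orthocomplete} if, for every family $(e_i)$ for which there are pairwise disjoint $\pi_i\in\Gamma_{\mathrm{ex}}(E)$ with $\pi_ie_i=e_i$, the family is orthosummable and every element orthogonal to all $e_i$ is orthogonal to its orthosum. Let $\sim$ be an equivalence relation on $E$. Elements $e,f$ are \emph{related} if there are nonzero $e_1\le e$, $f_1\le f$ with $e_1\sim f_1$, and \emph{unrelated} otherwise. Let $\Sigma_\sim(E)$ be the set of $\pi\in\Gamma_{\mathrm{ex}}(E)$ such that $e\in\pi(E)$, $f\in\pi'(E)$, $e\sim f$ imply $e=f=0$. The relation $\sim$ is a \emph{dimension equivalence relation} if, for all elements: (1) $e\sim0$ implies $e=0$; (2) if $(e_i)_{i\in I}$, $(f_i)_{i\in I}$ are orthosummable and $e_i\sim f_i$ for all $i$, then $\bigoplus_i e_i\sim\bigoplus_i f_i$; (3) if $p\sim s\oplus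 t$, then $p=e\oplus f$ with $e\sim s$, $f\sim t$; (4) if $e\oplus f=s\oplus t$, then $e=e_1\oplus e_2$, $f=f_1\oplus f_2$ with $s\sim e_1\oplus f_1$ and $t\sim e_2\oplus f_2$; (5) if $e\not\perp f$, then $e,f$ are related; (6) if $e\not\le f$, then there are nonzero $e_1\le e$ and $d_1\perp f$ with $e_1\sim d_1$; (7) if $e,f$ are unrelated, then there is $\pi\in\Sigma_\sim(E)$ with $e\in\pi(E)$ and $f\in\pi'(E)$. A \emph{dimension generalized effect algebra} (DGEA) is a centrally orthocomplete and Dedekind orthocomplete GEA with a dimension equivalence relation $\sim$. In a DGEA $E$ let $\eta_e$ be the smallest $\theta\in\Sigma_\sim(E)$ with $\theta e=e$, and $\Theta_\eta(E)=\{\eta_e:e\in E\}$. An element $p$ is \emph{faithful} if $\eta_p=1$; $k$ is \emph{simple} if every $e\le k$ is unrelated to $k\ominus e$; $f$ is \emph{finite} if $e\le f$, $e\sim f$ imply $e=f$; $c$ is \emph{invariant} if it is principal and $c\ge e\sim f\perp c$ implies $e=f=0$. Let $K$ and $F$ be the sets of simple and of finite elements, $\eta_K=\bigvee_{k\in K}\eta_k$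 and $\eta_F=\bigvee_{f\in F}\eta_f$ in $\Gamma_{\mathrm{ex}}(E)$, and let $\widetilde f$ be the largest finite invariant element. A DGEA is of \emph{type I} if it has a faithful simple element; of \emph{type II} if it has a faithful finite element but no nonzero simple element; of \emph{type III} if it has no nonzero finite element; of \emph{finite type} if it has a faithful finite invariant element; of \emph{properly non-finite type} if it has no nonzero finite invariant element; of type I$_F$ (II$_F$) if it is of type I (II) and of finite type; of type I$_{\neg F}$ (II$_{\neg F}$) if it is of type I (II) and of properly non-finite type. \textbf{Theorem.} Let $E$ be a DGEA with dimension equivalence relation $\sim$ and let $\pi\in\Sigma_\sim(E)$. The mappings $\eta_e$ ($e\in E$), $\eta_K$, $\eta_F$ and the element $\widetilde f$ exist, and $\pi(E)$, with the restrictions of $\oplus$ and $\sim$, is a DGEA. Moreover: \begin{enumerate} \item[(i)] If $\pi(E)$ is of type I, of type II, or of finite type, then $\pi\in\Theta_\eta(E)$. \item[(ii)] $\pi(E)$ is of type I iff $\pi\in\Theta_\eta(E)$ and $\pi\le\eta_K$. \item[(iii)] $\pi(E)$ is of type II iff $\pi\in\Theta_\eta(E)$ and $\pi\le\eta_F\wedge(\eta_K)'$.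 \item[(iv)] $\pi(E)$ is of type III iff $\pi\le(\eta_F)'$. \item[(v)] $\pi(E)$ is of finite type iff $\pi\in\Theta_\eta(E)$ and $\pi\le\eta_{\widetilde f}$. \item[(vi)] $\pi(E)$ is of properly non-finite type iff $\pi\wedge\eta_{\widetilde f}=0$. \item[(vii)] $\pi(E)$ is of type I$_F$ (respectively II$_F$) iff $\pi\in\Theta_\eta(E)$ and $\pi\le\eta_K\wedge\eta_{\widetilde f}$ (respectively $\pi\le\eta_F\wedge(\eta_K)'\wedge\eta_{\widetilde f}$). \item[(viii)] $\pi(E)$ is of type I$_{\neg F}$ (respectively II$_{\neg F}$) iff $\pi\in\Theta_\eta(E)$ and $\pi\le\eta_K\wedge(\eta_{\widetilde f})'$ (respectively $\pi\le\eta_F\wedge(\eta_K)'\wedge(\eta_{\widetilde f})'$). \end{enumerate} -/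

import Mathlib

universe u

/-- A generalized effect algebra. The partial operation `⊕` is given by its graph:
`OSum e f s` means that `e ⊕ f` is defined and equal to `s`. -/
class GEA (E : Type u) extends Zero E where
  OSum : E → E → E → Prop
  unique : ∀ {e f s t : E}, OSum e f s → OSum e f t → s = t
  comm : ∀ {e f s : E}, OSum e f s → OSum f e s
  assoc : ∀ {d e f s t : E}, OSum e f s → OSum d s t → ∃ r, OSum d e r ∧ OSum r f t
  osum_zero : ∀ e : E, OSum e 0 e
  cancel : ∀ {d e f s : E}, OSum d e s → OSum d f s → e = f
  positive : ∀ {e f : E}, OSum e f 0 → e = 0 ∧ f = 0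

namespace GEA

variable {E : Type u} [GEA E]

/-- `e ⊥ f`: the orthosum `e ⊕ f` is defined. -/
def Perp (e f : E) : Prop := ∃ s, OSum e f s

theorem assoc' {d e f r t : E} (h1 : OSum d e r) (h2 : OSum r f t) :
    ∃ s, OSum e f s ∧ OSum d s t := by
  obtain ⟨s, hs, ht⟩ := assoc (comm h1) (comm h2)
  exact ⟨s, comm hs, comm ht⟩

/-- `e ≤ f` iff `e ⊕ d = f` for some `d`. -/
instance instPartialOrder : PartialOrder E where
  le e f := ∃ d, OSum e d f
  le_refl e := ⟨0, osum_zero e⟩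
  le_trans := by
    rintro a b c ⟨x, hx⟩ ⟨y, hy⟩
    obtain ⟨s, -, hs⟩ := assoc' hx hy
    exact ⟨s, hs⟩
  le_antisymm := by
    rintro a b ⟨x, hx⟩ ⟨y, hy⟩
    obtain ⟨s, hs, ha⟩ := assoc' hx hy
    have h0 : s = 0 := cancel ha (osum_zero a)
    subst h0
    have hx0 := (positive hs).1
    subst hx0
    exact unique (osum_zero a) hx

theorem le_def {e f : E} : e ≤ f ↔ ∃ d, OSum e d f := Iff.rfl

theorem zero_le' (e : E) : (0 : E) ≤ e := ⟨e, comm (osum_zero e)⟩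

theorem eq_zero_of_le {e : E} (h : e ≤ 0) : e = 0 := le_antisymm h (zero_le' e)

/-- `(a ⊕ b) ⊕ (c ⊕ d) = (a ⊕ c) ⊕ (b ⊕ d)`, with existence of the right-hand side. -/
theorem osum_four {a b c d s t r : E} (h1 : OSum a b s) (h2 : OSum c d t) (h3 : OSum s t r) :
    ∃ x y, OSum a c x ∧ OSum b d y ∧ OSum x y r := by
  obtain ⟨p, hp, hpr⟩ := assoc' h1 h3
  obtain ⟨q, hq, hqp⟩ := assoc h2 hp
  obtain ⟨y, hy, hcy⟩ := assoc' (comm hq) hqp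
  obtain ⟨x, hx, hxy⟩ := assoc hcy hpr
  exact ⟨x, y, hx, hy, hxy⟩

/-- `FinOSum e J s`: the finite subfamily of `e` over `J` is orthogonal with orthosum `s`. -/
inductive FinOSum {I : Type u} (e : I → E) : Finset I → E → Prop
  | empty : FinOSum e ∅ 0
  | cons {i : I} {J : Finset I} (hi : i ∉ J) {s t : E} :
      FinOSum e J s → OSum s (e i) t → FinOSum e (Finset.cons i J hi) t

/-- A family is orthogonal iff each of its finite subfamilies is. -/
def Orthogonal {I : Type u} (e : I → E) : Prop := ∀ J : Finset I, ∃ s, FinOSum e J s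

/-- The set of all finite partial orthosums of a family. -/
def partialSums {I : Type u} (e : I → E) : Set E := {s | ∃ J : Finset I, FinOSum e J s}

/-- The family `e` is orthosummable with orthosum `s`. -/
def HasOSum {I : Type u} (e : I → E) (s : E) : Prop := Orthogonal e ∧ IsLUB (partialSums e) s

def Orthosummable {I : Type u} (e : I → E) : Prop := ∃ s, HasOSum e s

/-- Dedekind orthocompleteness. -/
def DedekindOrthocomplete (E : Type u) [GEA E] : Prop :=
  ∀ (I : Type u) (e : I → E), Orthogonal e → BddAbove (partialSums e) → Orthosummable e

/-- `p` is principal. -/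
def Principal (p : E) : Prop := ∀ e f s : E, e ≤ p → f ≤ p → OSum e f s → s ≤ p

end GEA

/-- The exocenter of a generalized effect algebra. -/
@[ext] structure GEX (E : Type u) [GEA E] where
  toFun : E → E
  map_osum' : ∀ {e f s : E}, GEA.OSum e f s → GEA.OSum (toFun e) (toFun f) (toFun s)
  idem' : ∀ e : E, toFun (toFun e) = toFun e
  decr' : ∀ e : E, toFun e ≤ e
  orth' : ∀ {e f : E}, toFun e = e → toFun f = 0 → GEA.Perp e f

namespace GEX

open GEA

variable {E : Type u} [GEA E]

instance : FunLike (GEX E) E E where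
  coe := toFun
  coe_injective := fun _ _ h => GEX.ext h

theorem ext_apply {π ξ : GEX E} (h : ∀ e, π e = ξ e) : π = ξ := DFunLike.ext _ _ h

theorem map_osum (π : GEX E) {e f s : E} (h : OSum e f s) : OSum (π e) (π f) (π s) :=
  π.map_osum' h

theorem idem (π : GEX E) (e : E) : π (π e) = π e := π.idem' e

theorem decr (π : GEX E) (e : E) : π e ≤ e := π.decr' e

theorem orth (π : GEX E) {e f : E} (he : π e = e) (hf : π f = 0) : Perp e f := π.orth' he hf

theorem map_zero (π : GEX E) : π 0 = 0 := eq_zero_of_le (π.decr 0)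

theorem mono (π : GEX E) {e f : E} (h : e ≤ f) : π e ≤ π f := by
  obtain ⟨d, hd⟩ := h
  exact ⟨π d, π.map_osum hd⟩

theorem map_of_le (π : GEX E) {x e : E} (hx : x ≤ e) (he : π e = e) : π x = x := by
  obtain ⟨y, hy⟩ := hx
  obtain ⟨x', hx'⟩ := π.decr x
  obtain ⟨y', hy'⟩ := π.decr y
  obtain ⟨p, q, hp, hq, hpq⟩ := osum_four hx' hy' hy
  have h1 := π.map_osum hy
  rw [he] at h1
  have hpe : p = e := unique hp h1
  subst hpe
  have hq0 : q = 0 := cancel hpq (osum_zero p)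
  subst hq0
  have hx0 := (positive hq).1
  subst hx0
  exact unique (osum_zero _) hx'

/-- The difference `e ⊖ π e`. -/
noncomputable def complFun (π : GEX E) (e : E) : E := Classical.choose (π.decr e)

theorem osum_complFun (π : GEX E) (e : E) : OSum (π e) (π.complFun e) e :=
  Classical.choose_spec (π.decr e)

theorem map_complFun (π : GEX E) (e : E) : π (π.complFun e) = 0 := by
  have h := π.map_osum (π.osum_complFun e)
  rw [π.idem] at h
  exact cancel h (osum_zero _)

theorem complFun_of_map_zero (π : GEX E) {e : E} (h : π e = 0) : π.complFun e = e := by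
  have h1 := π.osum_complFun e
  rw [h] at h1
  exact unique (comm (osum_zero _)) h1

/-- The complementary mapping `π'`, `π' e = e ⊖ π e`. -/
noncomputable instance : Compl (GEX E) where
  compl π :=
    { toFun := π.complFun
      map_osum' := by
        intro e f s h
        obtain ⟨p, q, hp, hq, hpq⟩ := osum_four (π.osum_complFun e) (π.osum_complFun f) h
        have h1 : p = π s := unique hp (π.map_osum h)
        subst h1
        rwa [cancel (π.osum_complFun s) hpq]
      idem' := fun e => π.complFun_of_map_zero (π.map_complFun e)
      decr' := fun e => ⟨π e, comm (π.osum_complFun e)⟩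
      orth' := by
        intro e f he hf
        have h1 : π e = 0 := by rw [← he]; exact π.map_complFun e
        have h2 := π.osum_complFun f
        rw [hf] at h2
        obtain ⟨s, hs⟩ := π.orth (unique (osum_zero _) h2) h1
        exact ⟨s, comm hs⟩ }

theorem osum_compl (π : GEX E) (e : E) : OSum (π e) (πᶜ e) e := π.osum_complFun e

theorem map_compl (π : GEX E) (e : E) : π (πᶜ e) = 0 := π.map_complFun e

theorem map_comm (π ξ : GEX E) (e : E) : π (ξ e) = ξ (π e) := by
  have h1 : π (ξ (π e)) = ξ (π e) := π.map_of_le (ξ.decr (π e)) (π.idem e)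
  have h2 : π (ξ (πᶜ e)) = 0 := by
    have h := π.mono (ξ.decr (πᶜ e))
    rw [map_compl] at h
    exact eq_zero_of_le h
  have h3 := π.map_osum (ξ.map_osum (π.osum_compl e))
  rw [h1, h2] at h3
  exact unique h3 (osum_zero _)

/-- The composition `π ∘ ξ`. -/
def comp (π ξ : GEX E) : GEX E where
  toFun e := π (ξ e)
  map_osum' h := π.map_osum (ξ.map_osum h)
  idem' e := by
    rw [map_comm ξ π, ξ.idem, π.idem]
  decr' e := le_trans (π.decr _) (ξ.decr e)
  orth' := by
    intro e f he hf
    have hξ : ξ e = e := le_antisymm (ξ.decr e) (by conv_lhs => rw [← he]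
                                                    exact π.decr _)
    have hπ : π e = e := by rw [hξ] at he; exact he
    obtain ⟨r, hr⟩ := π.orth hπ hf
    have hr' := ξ.map_osum hr
    rw [hξ, ξ.idem] at hr'
    obtain ⟨t, ht⟩ := ξ.orth (unique hr' hr) (ξ.map_compl f)
    obtain ⟨s, hs, hst⟩ := assoc' hr ht
    rw [unique hs (ξ.osum_compl f)] at hst
    exact ⟨t, hst⟩

/-- `π ≤ ξ` iff `π ∘ ξ = π`; the infimum of `π` and `ξ` is `π ∘ ξ`. -/
instance : SemilatticeInf (GEX E) where
  le π ξ := π.comp ξ = π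
  le_refl π := ext_apply π.idem
  le_trans π ξ ζ h1 h2 := by
    refine ext_apply fun e => ?_
    have e1 : ∀ x, π (ξ x) = π x := fun x => DFunLike.congr_fun h1 x
    have e2 : ∀ x, ξ (ζ x) = ξ x := fun x => DFunLike.congr_fun h2 x
    change π (ζ e) = π e
    rw [← e1, e2, e1]
  le_antisymm π ξ h1 h2 := by
    refine ext_apply fun e => ?_
    have e1 : π (ξ e) = π e := DFunLike.congr_fun h1 e
    have e2 : ξ (π e) = ξ e := DFunLike.congr_fun h2 e
    rw [← e1, map_comm, e2]
  inf := comp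
  inf_le_left π ξ := by
    refine ext_apply fun e => ?_
    change π (ξ (π e)) = π (ξ e)
    rw [map_comm ξ π, π.idem]
  inf_le_right π ξ := by
    refine ext_apply fun e => ?_
    change π (ξ (ξ e)) = π (ξ e)
    rw [ξ.idem]
  le_inf π ξ ζ h1 h2 := by
    refine ext_apply fun e => ?_
    have e1 : ∀ x, π (ξ x) = π x := fun x => DFunLike.congr_fun h1 x
    have e2 : ∀ x, π (ζ x) = π x := fun x => DFunLike.congr_fun h2 x
    change π (ξ (ζ e)) = π e
    rw [e1, e2]

/-- `⊥` is the zero mapping and `⊤` is the identity mapping. -/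
instance : BoundedOrder (GEX E) where
  top :=
    { toFun := fun e => e
      map_osum' := fun h => h
      idem' := fun _ => rfl
      decr' := fun e => le_refl e
      orth' := by
        intro e f _ hf
        subst hf
        exact ⟨e, osum_zero e⟩ }
  le_top _ := ext_apply fun _ => rfl
  bot :=
    { toFun := fun _ => 0
      map_osum' := fun _ => osum_zero 0
      idem' := fun _ => rfl
      decr' := fun e => zero_le' e
      orth' := by
        intro e f he _
        subst he
        exact ⟨f, comm (osum_zero f)⟩ }
  bot_le _ := ext_apply fun _ => rfl

/-- The direct summand `π(E) = {π e : e ∈ E}`. -/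
def Summand (π : GEX E) : Type u := {x : E // x ∈ Set.range π}

theorem map_val (π : GEX E) (x : π.Summand) : π x.1 = x.1 := by
  obtain ⟨e, he⟩ := x.2
  rw [← he, π.idem]

/-- `π(E)` with the restriction of `⊕`. -/
instance (π : GEX E) : GEA π.Summand where
  zero := ⟨0, 0, π.map_zero⟩
  OSum x y z := OSum x.1 y.1 z.1
  unique h1 h2 := Subtype.ext (unique h1 h2)
  comm h := comm h
  assoc := by
    intro d e f s t h1 h2
    obtain ⟨r, hr, ht⟩ := assoc h1 h2
    have h := π.map_osum hr
    rw [map_val, map_val] at h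
    exact ⟨⟨r, r, unique h hr⟩, hr, ht⟩
  osum_zero x := osum_zero x.1
  cancel h1 h2 := Subtype.ext (cancel h1 h2)
  positive h := ⟨Subtype.ext (positive h).1, Subtype.ext (positive h).2⟩

/-- The restriction of a relation on `E` to `π(E)`. -/
def restrict (π : GEX E) (sim : E → E → Prop) (x y : π.Summand) : Prop := sim x.1 y.1

end GEX

namespace DGEA

open GEA

variable {E : Type u} [GEA E]

/-- GEX-orthogonal families. -/
def GEXOrthogonal {I : Type u} (e : I → E) : Prop :=
  ∃ π : I → GEX E, (∀ i j, i ≠ j → π i ⊓ π j = ⊥) ∧ ∀ i, π i (e i) = e i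

/-- Central orthocompleteness. -/
structure CentrallyOrthocomplete (E : Type u) [GEA E] : Prop where
  co1 : ∀ (I : Type u) (e : I → E), GEXOrthogonal e → Orthosummable e
  co2 : ∀ (I : Type u) (e : I → E) (s x : E), GEXOrthogonal e → HasOSum e s →
    (∀ i, Perp x (e i)) → Perp x s

/-- Sherstnev–Kalinin congruences. -/
structure IsSKCongruence (sim : E → E → Prop) : Prop where
  equivalence : Equivalence sim
  sk1 : ∀ e : E, sim e 0 → e = 0
  sk2 : ∀ (I : Type u) (e f : I → E) (s t : E), HasOSum e s → HasOSum f t →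
    (∀ i, sim (e i) (f i)) → sim s t
  sk3d : ∀ p s t q : E, OSum s t q → sim p q →
    ∃ e f : E, OSum e f p ∧ sim e s ∧ sim f t
  sk3e : ∀ e f s t q : E, OSum e f q → OSum s t q →
    ∃ e₁ e₂ f₁ f₂ a b : E, OSum e₁ e₂ e ∧ OSum f₁ f₂ f ∧
      OSum e₁ f₁ a ∧ sim s a ∧ OSum e₂ f₂ b ∧ sim t b
  sk4a : ∀ e f : E, ¬ Perp e f →
    ∃ e₁ f₁ : E, e₁ ≠ 0 ∧ f₁ ≠ 0 ∧ e₁ ≤ e ∧ sim e₁ f₁ ∧ f₁ ≤ f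
  sk4b : ∀ e f : E, ¬ e ≤ f →
    ∃ e₁ d₁ : E, e₁ ≠ 0 ∧ d₁ ≠ 0 ∧ e₁ ≤ e ∧ sim e₁ d₁ ∧ Perp d₁ f

/-- `e` and `f` are related. -/
def Related (sim : E → E → Prop) (e f : E) : Prop :=
  ∃ e₁ f₁ : E, e₁ ≠ 0 ∧ f₁ ≠ 0 ∧ e₁ ≤ e ∧ sim e₁ f₁ ∧ f₁ ≤ f

/-- The set of all `π` in the exocenter that split `sim`. -/
def SigmaSim (sim : E → E → Prop) : Set (GEX E) :=
  {π | ∀ e ∈ Set.range π, ∀ f ∈ Set.range (πᶜ : GEX E), sim e f → e = 0 ∧ f = 0}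

/-- Dimension equivalence relations. -/
structure IsDER (sim : E → E → Prop) : Prop extends IsSKCongruence sim where
  sk4a' : ∀ e f : E, ¬ Related sim e f →
    ∃ π ∈ SigmaSim sim, e ∈ Set.range π ∧ f ∈ Set.range (πᶜ : GEX E)

/-- `E` with the relation `sim` is a dimension generalized effect algebra. -/
structure IsDGEA (sim : E → E → Prop) : Prop where
  centrallyOrthocomplete : CentrallyOrthocomplete E
  dedekindOrthocomplete : DedekindOrthocomplete E
  isDER : IsDER sim

open Classical in
/-- `η_e`, the smallest `θ ∈ Σ_∼(E)` with `θ e = e` (with a default value if there is none). -/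
noncomputable def hull (sim : E → E → Prop) (e : E) : GEX E :=
  if h : ∃ θ, IsLeast {θ : GEX E | θ ∈ SigmaSim sim ∧ θ e = e} θ then h.choose else ⊤

/-- The `η`-exocenter `Θ_η(E)`. -/
def ThetaEta (sim : E → E → Prop) : Set (GEX E) := Set.range (hull sim)

/-- `p` is faithful: `η_p = 1`. -/
def IsFaithfulElt (sim : E → E → Prop) (p : E) : Prop := hull sim p = ⊤

/-- `k` is simple: each subelement `e` of `k` is unrelated to `d = k ⊖ e`. -/
def IsSimpleElt (sim : E → E → Prop) (k : E) : Prop := ∀ e d : E, OSum e d k → ¬ Related sim e d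

/-- `f` is finite. -/
def IsFiniteElt (sim : E → E → Prop) (f : E) : Prop := ∀ e : E, e ≤ f → sim e f → e = f

/-- `c` is invariant. -/
def IsInvariantElt (sim : E → E → Prop) (c : E) : Prop :=
  Principal c ∧ ∀ e f : E, e ≤ c → sim e f → Perp f c → e = 0 ∧ f = 0

open Classical in
/-- The supremum in the exocenter of a set of mappings (with a default value if there is none). -/
noncomputable def supGEX (S : Set (GEX E)) : GEX E :=
  if h : ∃ θ, IsLUB S θ then h.choose else ⊥

/-- `η_K`, the supremum of all `η_k` with `k` simple. -/
noncomputable def etaK (sim : E → E → Prop) : GEX E := supGEX (hull sim '' {k | IsSimpleElt sim k})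

/-- `η_F`, the supremum of all `η_f` with `f` finite. -/
noncomputable def etaF (sim : E → E → Prop) : GEX E := supGEX (hull sim '' {f | IsFiniteElt sim f})

open Classical in
/-- The largest finite invariant element (with a default value if there is none). -/
noncomputable def fTilde (sim : E → E → Prop) : E :=
  if h : ∃ c, IsGreatest {c : E | IsFiniteElt sim c ∧ IsInvariantElt sim c} c then h.choose else 0

def IsTypeI (sim : E → E → Prop) : Prop := ∃ k, IsSimpleElt sim k ∧ IsFaithfulElt sim k

def IsTypeII (sim : E → E → Prop) : Prop :=
  (∃ f, IsFiniteElt sim f ∧ IsFaithfulElt sim f) ∧ ∀ k, IsSimpleElt sim k → k = 0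

def IsTypeIII (sim : E → E → Prop) : Prop := ∀ f, IsFiniteElt sim f → f = 0

def IsFiniteType (sim : E → E → Prop) : Prop :=
  ∃ f, IsFiniteElt sim f ∧ IsInvariantElt sim f ∧ IsFaithfulElt sim f

def IsProperlyNonFiniteType (sim : E → E → Prop) : Prop :=
  ∀ f, IsFiniteElt sim f → IsInvariantElt sim f → f = 0

def IsTypeIF (sim : E → E → Prop) : Prop := IsTypeI sim ∧ IsFiniteType sim

def IsTypeIIF (sim : E → E → Prop) : Prop := IsTypeII sim ∧ IsFiniteType sim

def IsTypeINotF (sim : E → E → Prop) : Prop := IsTypeI sim ∧ IsProperlyNonFiniteType sim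

def IsTypeIINotF (sim : E → E → Prop) : Prop := IsTypeII sim ∧ IsProperlyNonFiniteType sim

end DGEA

open DGEA

/-! The splitting axiom `sk4a'` makes unrelatedness rigid: unrelated elements are separated by some
mapping in the set `SigmaSim sim`, so the elements unrelated to a fixed `e` are closed under
arbitrary orthosums. By Dedekind orthocompleteness every `x` is then uniquely `f ⊕ r`, with `f`
unrelated to `e` and `r` unrelated to everything that is unrelated to `e`. The mapping sending `x`
to `r` is the hull of `e` (`exists_hull`, `isLeast_hull`). Thus the hull of `e` kills `f` exactly
when `e` and `f` are unrelated, and the hull of `θ e` is the meet of `θ` with the hull of `e`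
(`hull_map`).

Call a property of elements good if it is preserved by all mappings in `SigmaSim sim` and by
orthosums of families with disjoint hulls. Zorn's lemma and central orthocompleteness give a good
property `P` an element `p` whose hull dominates the hulls of all elements with `P`
(`exists_forall_hull_apply`). Being simple, being finite, and being finite and invariant are all
good; this produces `etaK`, `etaF` and `fTilde`.

For such `P` and `p`, an element with `P` and hull `π` exists iff `π` is a hull below that of `p`,
the witness being `π p` (`exists_hull_eq_iff`); and `π(E)` has no nonzero element with `P` iff `π`
is disjoint from the hull of `p` (`forall_eq_zero_iff`). All these notions pass between `π(E)` and
`E`, an element of `π(E)` being faithful there iff its hull in `E` is `π`, so every type criterion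
combines these two equivalences. -/

namespace GEA

variable {E : Type u} [GEA E]

/-! ### Order and orthosums of families -/

theorem osum_le_left {a b s : E} (h : OSum a b s) : a ≤ s := ⟨b, h⟩

theorem osum_le_right {a b s : E} (h : OSum a b s) : b ≤ s := ⟨a, comm h⟩

theorem osum_mono {a b c s t : E} (hab : a ≤ b) (h : OSum b c s) (h' : OSum a c t) : t ≤ s := by
  obtain ⟨d, hd⟩ := hab
  obtain ⟨q, hq, hq'⟩ := assoc' (comm hd) h
  rw [unique hq h'] at hq'
  exact osum_le_right hq'

theorem perp_of_le {a b c : E} (hab : a ≤ b) (h : Perp b c) : Perp a c := by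
  obtain ⟨d, hd⟩ := hab
  obtain ⟨s, hs⟩ := h
  obtain ⟨q, hq, -⟩ := assoc' (comm hd) hs
  exact ⟨q, hq⟩

theorem perp_comm {a b : E} (h : Perp a b) : Perp b a := by
  obtain ⟨s, hs⟩ := h
  exact ⟨s, comm hs⟩

theorem le_of_osum_le {a c d s t : E} (h : OSum a c s) (hst : s ≤ t) (ht : OSum d c t) : a ≤ d := by
  obtain ⟨x, hx⟩ := hst
  obtain ⟨p, hp, hp'⟩ := assoc' (comm h) hx
  rw [cancel (comm ht) hp']
  exact ⟨x, hp⟩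

theorem eq_zero_of_osum_self {a b : E} (h : OSum a b a) : b = 0 := cancel h (osum_zero a)

variable {I : Type u} {e : I → E}

theorem FinOSum.of_erase [DecidableEq I] {J : Finset I} {i : I} {s t : E} (hi : i ∈ J)
    (h : FinOSum e (J.erase i) s) (h' : OSum s (e i) t) : FinOSum e J t := by
  have h2 := FinOSum.cons (Finset.notMem_erase i J) h h'
  rwa [Finset.cons_eq_insert, Finset.insert_erase hi] at h2

theorem FinOSum.erase [DecidableEq I] {J : Finset I} {s : E} (h : FinOSum e J s) {i : I} (hi : i ∈ J) :
    ∃ t, FinOSum e (J.erase i) t ∧ OSum t (e i) s := by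
  induction h with
  | empty => simp at hi
  | @cons j J hj s t hs hst ih =>
    by_cases hij : i = j
    · subst hij
      refine ⟨s, ?_, hst⟩
      rwa [Finset.cons_eq_insert, Finset.erase_insert hj]
    · have hiJ : i ∈ J := by simpa [hij] using hi
      obtain ⟨r, hr, hrs⟩ := ih hiJ
      obtain ⟨a, ha, hat⟩ := assoc' hrs hst
      obtain ⟨b, hb, hbt⟩ := assoc (comm ha) hat
      refine ⟨b, ?_, hbt⟩
      have h2 := FinOSum.cons (fun h => hj (Finset.mem_of_mem_erase h)) hr hb
      rw [Finset.cons_eq_insert] at h2 ⊢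
      rwa [Finset.erase_insert_of_ne (Ne.symm hij)]

theorem FinOSum.cons_inv {J : Finset I} {i : I} {hi : i ∉ J} {s : E}
    (h : FinOSum e (Finset.cons i J hi) s) : ∃ t, FinOSum e J t ∧ OSum t (e i) s := by
  classical
  obtain ⟨t, ht, hts⟩ := h.erase (Finset.mem_cons_self i J)
  refine ⟨t, ?_, hts⟩
  rwa [Finset.cons_eq_insert, Finset.erase_insert hi] at ht

theorem FinOSum.empty_inv {s : E} (h : FinOSum e ∅ s) : s = 0 := by
  generalize hJ : (∅ : Finset I) = J at h
  cases h with
  | empty => rfl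
  | cons hi => exact absurd hJ.symm (Finset.cons_ne_empty hi)

theorem FinOSum.unique {J : Finset I} {s t : E} (hs : FinOSum e J s) (ht : FinOSum e J t) :
    s = t := by
  induction hs generalizing t with
  | empty => exact ht.empty_inv.symm
  | cons hi _ h ih =>
    obtain ⟨r, hr, hrt⟩ := ht.cons_inv
    rw [← ih hr] at hrt
    exact GEA.unique h hrt

theorem FinOSum.subset {J : Finset I} {s : E} (h : FinOSum e J s) {K : Finset I} (hK : K ⊆ J) :
    ∃ t, FinOSum e K t ∧ t ≤ s := by
  classical
  induction h generalizing K with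
  | empty =>
    rw [Finset.subset_empty.1 hK]
    exact ⟨0, FinOSum.empty, le_refl _⟩
  | @cons i J hi s t _ hst ih =>
    have hK' : K.erase i ⊆ J := fun x hx => by
      have := hK (Finset.mem_of_mem_erase hx)
      simpa [Finset.ne_of_mem_erase hx] using this
    obtain ⟨r, hr, hrs⟩ := ih hK'
    by_cases hiK : i ∈ K
    · obtain ⟨q, hq⟩ := perp_of_le hrs ⟨t, hst⟩
      exact ⟨q, FinOSum.of_erase hiK hr hq, osum_mono hrs hst hq⟩
    · rw [Finset.erase_eq_of_notMem hiK] at hr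
      exact ⟨r, hr, hrs.trans (osum_le_left hst)⟩

theorem FinOSum.singleton (e : I → E) (i : I) : FinOSum e {i} (e i) :=
  FinOSum.cons (Finset.notMem_empty i) FinOSum.empty (comm (osum_zero _))

theorem FinOSum.comap {I' : Type u} (φ : I' ↪ I) {J : Finset I'} {s : E}
    (h : FinOSum e (J.map φ) s) : FinOSum (fun i => e (φ i)) J s := by
  induction J using Finset.cons_induction generalizing s with
  | empty =>
    rw [Finset.map_empty] at h
    rw [h.empty_inv]
    exact FinOSum.empty
  | cons i J hi ih =>
    rw [Finset.map_cons] at h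
    obtain ⟨t, ht, hts⟩ := h.cons_inv
    exact FinOSum.cons hi (ih ht) hts

theorem HasOSum.le {s : E} (h : HasOSum e s) (i : I) : e i ≤ s :=
  h.2.1 ⟨{i}, FinOSum.singleton e i⟩

theorem hasOSum_of_finOSum_univ [Fintype I] {s : E} (h : FinOSum e Finset.univ s) :
    HasOSum e s := by
  refine ⟨fun J => ?_, ?_, fun u hu => hu ⟨_, h⟩⟩
  · obtain ⟨t, ht, -⟩ := h.subset (Finset.subset_univ J)
    exact ⟨t, ht⟩
  · rintro t ⟨J, hJ⟩
    obtain ⟨t', ht', hle⟩ := h.subset (Finset.subset_univ J)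
    rwa [hJ.unique ht']

theorem hasOSum_pair {a b s : E} (h : OSum a b s) :
    HasOSum (fun i : ULift.{u} Bool => if i.down then a else b) s := by
  apply hasOSum_of_finOSum_univ
  have h1 := FinOSum.singleton (fun i : ULift.{u} Bool => if i.down then a else b) ⟨true⟩
  have h2 := FinOSum.cons (i := ⟨false⟩) (by simp) h1 (t := s) (by simpa using h)
  convert h2 using 1
  ext ⟨b⟩
  cases b <;> simp

/-- A maximal orthogonal family of elements below `x` with property `A` splits `x` into an element
with property `A` and a remainder without nonzero subelements with property `A`. -/
theorem exists_osum_of_closed (hD : DedekindOrthocomplete E) (A : E → Prop)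
    (hA : ∀ (I : Type u) (f : I → E) (s : E), HasOSum f s → (∀ i, A (f i)) → A s) (x : E) :
    ∃ s r, OSum s r x ∧ A s ∧ ∀ g ≤ r, A g → g = 0 := by
  classical
  -- The second coordinate gives every element countably many labels, so that a family may repeat an
  -- element.
  let F : Set (Set (E × ℕ)) := {T | (∀ p ∈ T, A p.1) ∧
    ∀ J : Finset (E × ℕ), ↑J ⊆ T → ∃ s ≤ x, FinOSum Prod.fst J s}
  have hF : Order.IsOfFiniteCharacter F := by
    intro T
    constructor
    · rintro ⟨h1, h2⟩ T' hT' -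
      exact ⟨fun p hp => h1 p (hT' hp), fun J hJ => h2 J (hJ.trans hT')⟩
    · intro h
      refine ⟨fun p hp => ?_, fun J hJ => ?_⟩
      · exact (h {p} (by simpa using hp) (Set.finite_singleton p)).1 p rfl
      · exact (h J hJ J.finite_toSet).2 J subset_rfl
  have h0 : (∅ : Set (E × ℕ)) ∈ F := by
    refine ⟨by simp, fun J hJ => ⟨0, zero_le' x, ?_⟩⟩
    have : J = ∅ := by simpa using hJ
    rw [this]
    exact FinOSum.empty
  obtain ⟨T, -, hT⟩ := hF.exists_maximal h0
  obtain ⟨hT1, hT2⟩ := hT.prop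
  let φ : T ↪ E × ℕ := Function.Embedding.subtype _
  let f : T → E := fun t => t.1.1
  have hmap : ∀ J : Finset T, ∃ s ≤ x, FinOSum f J s := by
    intro J
    obtain ⟨s, hs, hJ⟩ := hT2 (J.map φ) (by
      intro p hp
      simp only [Finset.coe_map, Set.mem_image] at hp
      obtain ⟨q, -, rfl⟩ := hp
      exact q.2)
    exact ⟨s, hs, hJ.comap φ⟩
  have horth : Orthogonal f := fun J => by
    obtain ⟨s, -, hs⟩ := hmap J
    exact ⟨s, hs⟩
  have hbdd : x ∈ upperBounds (partialSums f) := by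
    rintro t ⟨J, hJ⟩
    obtain ⟨s, hs, hJ'⟩ := hmap J
    rwa [hJ.unique hJ']
  obtain ⟨s, hs⟩ := hD T f horth ⟨x, hbdd⟩
  obtain ⟨r, hr⟩ : s ≤ x := hs.2.2 hbdd
  have hfin : ∀ (J : Finset (E × ℕ)) (p : E), ↑J ⊆ T → FinOSum Prod.fst J p → p ≤ s := by
    intro J p hJ hp
    have h1 : (J.subtype (· ∈ T)).map φ = J := Finset.subtype_map_of_mem hJ
    rw [← h1] at hp
    exact hs.2.1 ⟨_, hp.comap φ⟩
  refine ⟨s, r, hr, hA T f s hs fun i => hT1 i.1 i.2, fun g hg hAg => ?_⟩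
  by_contra hg0
  -- If every copy of `g` were used, each finite partial orthosum would omit one and so lie below
  -- `d`, where `s = g ⊕ d`. Then `s ≤ d`, which forces `g = 0`.
  obtain ⟨n, hn⟩ : ∃ n : ℕ, (g, n) ∉ T := by
    by_contra! hall
    obtain ⟨d, hd⟩ : g ≤ s := hs.le ⟨(g, 0), hall 0⟩
    have hd' : s ≤ d := by
      refine hs.2.2 ?_
      rintro p ⟨J, hJ⟩
      obtain ⟨n, hn⟩ : ∃ n : ℕ, (⟨(g, n), hall n⟩ : T) ∉ J := by
        by_contra! hJall
        refine Set.infinite_univ (α := ℕ) (((J.image fun t => t.1.2).finite_toSet).subset ?_)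
        intro n _
        simp only [Finset.coe_image, Set.mem_image]
        exact ⟨_, hJall n, rfl⟩
      obtain ⟨q, hq⟩ := horth (Finset.cons _ J hn)
      obtain ⟨p', hp', hp'q⟩ := hq.cons_inv
      rw [← hJ.unique hp'] at hp'q
      exact le_of_osum_le hp'q (hs.2.1 ⟨_, hq⟩) (comm hd)
    have : d = s := le_antisymm (osum_le_right hd) hd'
    subst this
    exact hg0 (eq_zero_of_osum_self (comm hd))
  -- An unused copy of `g` can be adjoined: finite sums from `T` lie below `s` and `g ≤ r`, so the
  -- enlarged sums stay below `s ⊕ r = x`. This contradicts maximality.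
  refine hn (hT.le_of_ge (y := insert (g, n) T) ⟨?_, ?_⟩ (Set.subset_insert _ _)
    (Set.mem_insert _ _))
  · rintro p (rfl | hp)
    · exact hAg
    · exact hT1 p hp
  · intro J hJ
    have hJ' : ↑(J.erase (g, n)) ⊆ T := by
      intro p hp
      simp only [Finset.coe_erase, Set.mem_sdiff, Set.mem_singleton_iff] at hp
      exact (hJ hp.1).resolve_left hp.2
    obtain ⟨p, hpx, hp⟩ := hT2 _ hJ'
    by_cases hgJ : (g, n) ∈ J
    · obtain ⟨q, hq⟩ := perp_comm (perp_of_le hg (perp_comm ⟨x, hr⟩))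
      obtain ⟨w, hw⟩ := perp_of_le (hfin _ _ hJ' hp) ⟨q, hq⟩
      refine ⟨w, ?_, FinOSum.of_erase hgJ hp hw⟩
      exact (osum_mono (hfin _ _ hJ' hp) hq hw).trans (osum_mono hg (comm hr) (comm hq))
    · rw [Finset.erase_eq_of_notMem hgJ] at hp
      exact ⟨p, hpx, hp⟩

end GEA

/-! ### Mappings in the exocenter -/

namespace GEX

open GEA

variable {E : Type u} [GEA E]

theorem mem_range_iff {π : GEX E} {e : E} : e ∈ Set.range π ↔ π e = e :=
  ⟨by rintro ⟨x, rfl⟩; exact π.idem x, fun h => ⟨e, h⟩⟩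

theorem compl_apply_eq_self_iff {π : GEX E} {e : E} : πᶜ e = e ↔ π e = 0 := by
  constructor
  · intro h
    rw [← h]
    exact π.map_compl e
  · intro h
    have h1 := π.osum_compl e
    rw [h] at h1
    exact unique (comm (osum_zero _)) h1

theorem compl_apply_eq_zero_iff {π : GEX E} {e : E} : πᶜ e = 0 ↔ π e = e := by
  have h1 := π.osum_compl e
  constructor
  · intro h
    rw [h] at h1
    exact unique (osum_zero _) h1
  · intro h
    rw [h] at h1
    exact eq_zero_of_osum_self h1

theorem mem_range_compl_iff {π : GEX E} {e : E} : e ∈ Set.range (πᶜ : GEX E) ↔ π e = 0 := by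
  rw [mem_range_iff, compl_apply_eq_self_iff]

theorem map_eq_zero_of_le (π : GEX E) {x e : E} (hx : x ≤ e) (he : π e = 0) : π x = 0 := by
  have := π.mono hx
  rw [he] at this
  exact eq_zero_of_le this

theorem inf_apply (π ξ : GEX E) (e : E) : (π ⊓ ξ) e = π (ξ e) := rfl

theorem bot_apply (e : E) : (⊥ : GEX E) e = 0 := rfl

theorem le_iff {π ξ : GEX E} : π ≤ ξ ↔ ∀ e, π e = e → ξ e = e := by
  constructor
  · intro h e he
    have h1 : π (ξ e) = π e := DFunLike.congr_fun (show π.comp ξ = π from h) e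
    rw [map_comm, he] at h1
    exact h1
  · intro h
    refine ext_apply fun e => ?_
    change π (ξ e) = π e
    rw [map_comm, h _ (π.idem e)]

theorem le_compl_iff {π ξ : GEX E} : π ≤ ξᶜ ↔ π ⊓ ξ = ⊥ := by
  rw [le_iff]
  constructor
  · intro h
    refine ext_apply fun e => ?_
    have := compl_apply_eq_self_iff.1 (h _ (π.idem e))
    rw [inf_apply, map_comm, this, bot_apply]
  · intro h e he
    rw [compl_apply_eq_self_iff, ← he, map_comm, ← inf_apply, h, bot_apply]

/-- Apply the complement of `π`: it fixes `f` and kills `g`, so only the contribution of `d` is left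
above `f`. -/
theorem map_le_of_le_osum (π : GEX E) {f g d s : E} (h : OSum g d s) (hfs : f ≤ s)
    (hf : π f = 0) (hg : π g = g) : f ≤ d := by
  have h1 := (πᶜ).map_osum h
  rw [compl_apply_eq_zero_iff.2 hg] at h1
  have h2 := (πᶜ).mono hfs
  rw [compl_apply_eq_self_iff.2 hf, ← unique (comm (osum_zero _)) h1] at h2
  exact h2.trans ((πᶜ).decr d)

theorem map_finOSum (π : GEX E) {I : Type u} {e : I → E} {J : Finset I} {s : E}
    (h : FinOSum e J s) : FinOSum (fun i => π (e i)) J (π s) := by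
  induction h with
  | empty =>
    rw [π.map_zero]
    exact FinOSum.empty
  | cons hi _ h ih => exact FinOSum.cons hi ih (π.map_osum h)

theorem map_hasOSum (π : GEX E) {I : Type u} {e : I → E} {s : E} (h : HasOSum e s) :
    HasOSum (fun i => π (e i)) (π s) := by
  refine ⟨fun J => ?_, ?_, fun u hu => ?_⟩
  · obtain ⟨t, ht⟩ := h.1 J
    exact ⟨π t, π.map_finOSum ht⟩
  · rintro t ⟨J, hJ⟩
    obtain ⟨r, hr⟩ := h.1 J
    rw [hJ.unique (π.map_finOSum hr)]
    exact π.mono (h.2.1 ⟨J, hr⟩)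
  -- For an upper bound `u` of the image sums, `w = π u ⊕ πᶜ s` bounds the original sums. Hence `s ≤
  -- w`, and applying `π` gives `π s ≤ π u`.
  · obtain ⟨w, hw⟩ := π.orth (π.idem u) (π.map_compl s)
    have hsw : s ≤ w := by
      refine h.2.2 ?_
      rintro t ⟨J, hJ⟩
      have h1 : π t ≤ π u := by
        have := π.mono (hu ⟨J, π.map_finOSum hJ⟩)
        rwa [π.idem] at this
      have h2 : πᶜ t ≤ πᶜ s := (πᶜ).mono (h.2.1 ⟨J, hJ⟩)
      obtain ⟨v, hv⟩ := perp_of_le h1 ⟨w, hw⟩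
      exact (osum_mono h2 (comm hv) (comm (π.osum_compl t))).trans (osum_mono h1 hw hv)
    have h3 := π.map_osum hw
    rw [π.idem, π.map_compl] at h3
    have h4 := π.mono hsw
    rw [← unique (osum_zero _) h3] at h4
    exact h4.trans (π.decr u)

end GEX

namespace GEA

variable {E : Type u} [GEA E] {I : Type u} {e : I → E}

theorem HasOSum.eq_of_forall_ne {s : E} (h : HasOSum e s) {i : I} (hi : ∀ j ≠ i, e j = 0) :
    s = e i := by
  refine le_antisymm (h.2.2 ?_) (h.le i)
  rintro t ⟨J, hJ⟩
  have key : (i ∈ J → t = e i) ∧ (i ∉ J → t = 0) := by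
    induction hJ with
    | empty => simp
    | @cons j J hj s t _ hst ih =>
      by_cases hji : j = i
      · subst hji
        rw [ih.2 hj] at hst
        simpa using unique hst (comm (osum_zero _))
      · rw [hi j hji] at hst
        rw [unique hst (osum_zero _)]
        simpa [Ne.symm hji] using ih
  by_cases hiJ : i ∈ J
  · exact (key.1 hiJ).le
  · rw [key.2 hiJ]
    exact zero_le' _

end GEA

/-! ### Relatedness and mappings that split the relation -/

namespace DGEA

open GEA GEX

variable {E : Type u} [GEA E] {sim : E → E → Prop}

theorem Related.mono {e e' f f' : E} (h : Related sim e f) (he : e ≤ e') (hf : f ≤ f') :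
    Related sim e' f' := by
  obtain ⟨a, b, ha, hb, hae, hab, hbf⟩ := h
  exact ⟨a, b, ha, hb, hae.trans he, hab, hbf.trans hf⟩

theorem Related.symm (hs : IsSKCongruence sim) {e f : E} (h : Related sim e f) :
    Related sim f e := by
  obtain ⟨a, b, ha, hb, hae, hab, hbf⟩ := h
  exact ⟨b, a, hb, ha, hbf, hs.equivalence.symm hab, hae⟩

namespace IsSKCongruence

variable (hs : IsSKCongruence sim)
include hs

theorem eq_zero_left {e f : E} (h : sim e f) (hf : f = 0) : e = 0 := by
  subst hf
  exact hs.sk1 e h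

theorem eq_zero_right {e f : E} (h : sim e f) (he : e = 0) : f = 0 :=
  hs.eq_zero_left (hs.equivalence.symm h) he

theorem exists_le {e f e' : E} (h : sim e f) (he : e' ≤ e) : ∃ f' ≤ f, sim e' f' := by
  obtain ⟨d, hd⟩ := he
  obtain ⟨a, b, hab, ha, -⟩ := hs.sk3d f e' d e hd (hs.equivalence.symm h)
  exact ⟨a, osum_le_left hab, hs.equivalence.symm ha⟩

theorem osum {a b c d s t : E} (h₁ : OSum a b s) (h₂ : OSum c d t) (hac : sim a c)
    (hbd : sim b d) : sim s t := by
  refine hs.sk2 _ _ _ s t (hasOSum_pair h₁) (hasOSum_pair h₂) ?_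
  rintro ⟨_ | _⟩
  · simpa using hbd
  · simpa using hac

theorem related_of_sim {e f : E} (h : sim e f) (he : e ≠ 0) : Related sim e f :=
  ⟨e, f, he, fun hf => he (hs.eq_zero_left h hf), le_refl e, h, le_refl f⟩

end IsSKCongruence

theorem mem_SigmaSim_iff {θ : GEX E} :
    θ ∈ SigmaSim sim ↔ ∀ e f, θ e = e → θ f = 0 → sim e f → e = 0 ∧ f = 0 := by
  constructor
  · intro h e f he hf
    exact h e (mem_range_iff.2 he) f (mem_range_compl_iff.2 hf)
  · intro h e he f hf
    exact h e f (mem_range_iff.1 he) (mem_range_compl_iff.1 hf)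

theorem not_related_zero (e : E) : ¬ Related sim e 0 := by
  rintro ⟨-, b, -, hb, -, -, hb0⟩
  exact hb (eq_zero_of_le hb0)

theorem not_related_of_map {θ : GEX E} (hθ : θ ∈ SigmaSim sim) {e f : E} (he : θ e = e)
    (hf : θ f = 0) : ¬ Related sim e f := by
  rintro ⟨a, b, ha, -, hae, hab, hbf⟩
  exact ha (mem_SigmaSim_iff.1 hθ a b (θ.map_of_le hae he) (θ.map_eq_zero_of_le hbf hf) hab).1

section Sigma

variable (hs : IsSKCongruence sim)
include hs

theorem compl_mem_SigmaSim {θ : GEX E} (hθ : θ ∈ SigmaSim sim) : θᶜ ∈ SigmaSim sim := by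
  rw [mem_SigmaSim_iff] at hθ ⊢
  intro e f he hf h
  rw [compl_apply_eq_self_iff] at he
  rw [compl_apply_eq_zero_iff] at hf
  exact (hθ f e hf he (hs.equivalence.symm h)).symm

/-- The part of `f` in the complement of `θ` is equivalent to a subelement of `e`, hence to an
element of `θ(E)`; splitting makes it zero. -/
theorem map_eq_self_of_sim {θ : GEX E} (hθ : θ ∈ SigmaSim sim) {e f : E} (h : sim e f)
    (he : θ e = e) : θ f = f := by
  obtain ⟨a, ha, hfa⟩ := hs.exists_le (hs.equivalence.symm h) ((θᶜ).decr f)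
  have hθa := θ.map_of_le ha he
  exact compl_apply_eq_zero_iff.1
    (mem_SigmaSim_iff.1 hθ a _ hθa (θ.map_compl f) (hs.equivalence.symm hfa)).2

theorem map_eq_zero_of_sim {θ : GEX E} (hθ : θ ∈ SigmaSim sim) {e f : E} (h : sim e f)
    (he : θ e = 0) : θ f = 0 :=
  compl_apply_eq_self_iff.1
    (map_eq_self_of_sim hs (compl_mem_SigmaSim hs hθ) h (compl_apply_eq_self_iff.2 he))

/-- Decompose `e` along `f = θ f ⊕ θᶜ f`. The two pieces lie in complementary summands, so the first
of them must be `θ e`. -/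
theorem sim_map {θ : GEX E} (hθ : θ ∈ SigmaSim sim) {e f : E} (h : sim e f) :
    sim (θ e) (θ f) := by
  obtain ⟨a, b, hab, ha, hb⟩ := hs.sk3d e _ _ f (θ.osum_compl f) h
  have ha' := map_eq_self_of_sim hs hθ (hs.equivalence.symm ha) (θ.idem f)
  have hb' := map_eq_zero_of_sim hs hθ (hs.equivalence.symm hb) (θ.map_compl f)
  have h1 := θ.map_osum hab
  rw [ha', hb'] at h1
  rwa [unique h1 (osum_zero a)]

theorem inf_mem_SigmaSim {θ ξ : GEX E} (hθ : θ ∈ SigmaSim sim) (hξ : ξ ∈ SigmaSim sim) :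
    θ ⊓ ξ ∈ SigmaSim sim := by
  rw [mem_SigmaSim_iff]
  intro e f he hf h
  have h1 : θ e = e := le_iff.1 (inf_le_left : θ ⊓ ξ ≤ θ) e he
  have h2 : ξ e = e := le_iff.1 (inf_le_right : θ ⊓ ξ ≤ ξ) e he
  have h3 := map_eq_self_of_sim hs hθ h h1
  have h4 := map_eq_self_of_sim hs hξ h h2
  rw [inf_apply, h4, h3] at hf
  exact ⟨hs.eq_zero_left h hf, hf⟩

end Sigma

/-! ### Unrelatedness and the construction of hulls -/

section DER

variable (hd : IsDER sim)
include hd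

theorem not_related_iff {e f : E} :
    ¬ Related sim e f ↔ ∃ θ ∈ SigmaSim sim, θ e = e ∧ θ f = 0 := by
  constructor
  · intro h
    obtain ⟨θ, hθ, he, hf⟩ := hd.sk4a' e f h
    exact ⟨θ, hθ, mem_range_iff.1 he, mem_range_compl_iff.1 hf⟩
  · rintro ⟨θ, hθ, he, hf⟩
    exact not_related_of_map hθ he hf

/-- The meet of the two separating mappings fixes `g` and kills both summands. -/
theorem not_related_osum {g a b s : E} (h : OSum a b s) (ha : ¬ Related sim g a)
    (hb : ¬ Related sim g b) : ¬ Related sim g s := by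
  obtain ⟨θ, hθ, h1, h2⟩ := (not_related_iff hd).1 ha
  obtain ⟨ξ, hξ, h3, h4⟩ := (not_related_iff hd).1 hb
  refine (not_related_iff hd).2 ⟨θ ⊓ ξ, inf_mem_SigmaSim hd.toIsSKCongruence hθ hξ, ?_, ?_⟩
  · rw [inf_apply, h3, h1]
  · have h5 := (θ ⊓ ξ).map_osum h
    rw [inf_apply, inf_apply θ ξ b, h4, map_comm, h2, θ.map_zero, ξ.map_zero] at h5
    exact unique h5 (osum_zero 0)

theorem not_related_finOSum {I : Type u} {e : I → E} {J : Finset I} {g s : E}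
    (h : FinOSum e J s) (hg : ∀ i, ¬ Related sim g (e i)) : ¬ Related sim g s := by
  induction h with
  | empty =>
    rintro ⟨-, b, -, hb, -, -, hb0⟩
    exact hb (eq_zero_of_le hb0)
  | cons _ _ h ih => exact not_related_osum hd h ih (hg _)

/-- Write `s = g ⊕ d`. Every finite partial sum is separated from `g`, hence lies below `d`; so the
supremum `s` does too. -/
theorem eq_zero_of_le_hasOSum {I : Type u} {e : I → E} {g s : E} (h : HasOSum e s)
    (hgs : g ≤ s) (hg : ∀ i, ¬ Related sim g (e i)) : g = 0 := by
  obtain ⟨d, hgd⟩ := hgs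
  have hsd : s ≤ d := by
    refine h.2.2 ?_
    rintro t ⟨J, hJ⟩
    obtain ⟨θ, -, h1, h2⟩ := (not_related_iff hd).1 (not_related_finOSum hd hJ hg)
    exact θ.map_le_of_le_osum hgd (h.2.1 ⟨J, hJ⟩) h2 h1
  have : d = s := le_antisymm (osum_le_right hgd) hsd
  subst this
  exact eq_zero_of_osum_self (comm hgd)

/-- A subelement of `s` equivalent to a subelement of `g` inherits unrelatedness to every member of
the family, so it vanishes by `eq_zero_of_le_hasOSum`. -/
theorem not_related_hasOSum {I : Type u} {e : I → E} {g s : E} (h : HasOSum e s)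
    (hg : ∀ i, ¬ Related sim g (e i)) : ¬ Related sim g s := by
  rintro ⟨a, b, -, hb, hag, hab, hbs⟩
  refine hb (eq_zero_of_le_hasOSum hd h hbs fun i => ?_)
  intro hr
  obtain ⟨c, d, hc, hd0, hcb, hcd, hdi⟩ := hr
  obtain ⟨c', hc'a, hcc'⟩ := hd.exists_le (hd.equivalence.symm hab) hcb
  exact hg i ⟨c', d, fun h0 => hc (hd.eq_zero_left hcc' h0), hd0, hc'a.trans hag,
    hd.equivalence.trans (hd.equivalence.symm hcc') hcd, hdi⟩

/-- Take `f` from a maximal family of elements unrelated to `e`. If a piece of the remainder were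
equivalent to a piece of some `g` unrelated to `e`, it would itself be unrelated to `e`,
contradicting maximality. -/
theorem exists_split (hD : DedekindOrthocomplete E) (e x : E) :
    ∃ f r, OSum f r x ∧ ¬ Related sim e f ∧ ∀ g, ¬ Related sim e g → ¬ Related sim r g := by
  obtain ⟨f, r, hfr, hf, hr⟩ := exists_osum_of_closed hD (fun f => ¬ Related sim e f)
    (fun I f s h hf => not_related_hasOSum hd h hf) x
  refine ⟨f, r, hfr, hf, ?_⟩
  rintro g hg ⟨a, b, ha, -, har, hab, hbg⟩
  refine ha (hr a har ?_)
  rintro ⟨c, d, hc, hd0, hce, hcd, hda⟩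
  obtain ⟨b', hb'b, hdb'⟩ := hd.exists_le hab hda
  exact hg ⟨c, b', hc, fun h0 => hd0 (hd.eq_zero_left hdb' h0), hce,
    hd.equivalence.trans hcd hdb', hb'b.trans hbg⟩

/-- Each `A`-part is separated from the other decomposition's remainder, so `map_le_of_le_osum`
places it below the other `A`-part. -/
theorem split_unique {A : E → Prop} {f r f' r' x : E} (h : OSum f r x) (h' : OSum f' r' x)
    (hf : A f) (hf' : A f') (hr : ∀ g, A g → ¬ Related sim r g)
    (hr' : ∀ g, A g → ¬ Related sim r' g) : r = r' := by
  have key : ∀ {f r f' r' : E}, OSum f r x → OSum f' r' x → A f →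
      (∀ g, A g → ¬ Related sim r' g) → f ≤ f' := by
    intro f r f' r' h h' hf hr'
    obtain ⟨θ, -, h1, h2⟩ := (not_related_iff hd).1 (hr' f hf)
    exact θ.map_le_of_le_osum (comm h') (osum_le_left h) h2 h1
  have : f = f' := le_antisymm (key h h' hf hr') (key h' h hf' hr)
  subst this
  exact cancel h h'

/-- The projection onto the elements unrelated to all elements unrelated to `e`. -/
theorem exists_hull (hD : DedekindOrthocomplete E) (e : E) :
    ∃ θ ∈ SigmaSim sim, θ e = e ∧ ∀ f, ¬ Related sim e f → θ f = 0 := by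
  have hs := hd.toIsSKCongruence
  choose F R hFR hF hR using exists_split hd hD e
  have hu : ∀ {f r x : E}, OSum f r x → ¬ Related sim e f →
      (∀ g, ¬ Related sim e g → ¬ Related sim r g) → R x = r := fun {f r x} h hf hr =>
    split_unique hd (A := fun g => ¬ Related sim e g) (hFR x) h (hF x) hf (hR x) hr
  have hzero : ∀ {f : E}, R f = 0 → ¬ Related sim e f := by
    intro f hf
    have h1 := hFR f
    rw [hf] at h1
    have h2 := hF f
    rwa [unique (osum_zero _) h1] at h2
  -- The mapping takes the remainder `R x`. Uniqueness of the splitting yields additivity and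
  -- idempotence; for `orth'`, an element fixed by `R` and one killed by `R` are unrelated, and
  -- `sk4a` makes them orthogonal.
  let θ : GEX E :=
    { toFun := R
      map_osum' := by
        intro x y z h
        obtain ⟨p, q, hp, hq, hpq⟩ := osum_four (hFR x) (hFR y) h
        rw [hu hpq (not_related_osum hd hp (hF x) (hF y)) fun g hg hr =>
          not_related_osum hd hq (fun h => hR x g hg (h.symm hs))
            (fun h => hR y g hg (h.symm hs)) (hr.symm hs)]
        exact hq
      idem' := fun x => hu (comm (osum_zero _)) (not_related_zero e) (hR x)
      decr' := fun x => osum_le_right (hFR x)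
      orth' := by
        intro x y hx hy
        by_contra hxy
        exact hR x y (hzero hy) (by rw [hx]; exact hd.sk4a x y hxy) }
  refine ⟨θ, ?_, hu (comm (osum_zero _)) (not_related_zero e) fun g hg => hg, ?_⟩
  · rw [mem_SigmaSim_iff]
    intro x y hx hy hxy
    have hx' : R x = x := hx
    have h1 := hR x y (hzero hy)
    rw [hx'] at h1
    have hx0 : x = 0 := by
      by_contra hx0
      exact h1 (hs.related_of_sim hxy hx0)
    exact ⟨hx0, hs.eq_zero_right hxy hx0⟩
  · intro f hf
    exact hu (osum_zero f) hf fun g _ hr => not_related_zero g (hr.symm hs)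

end DER

/-! ### Calculus of hulls and maximal families -/

section Hull

variable (hE : IsDGEA sim)
include hE

theorem isLeast_hull (e : E) : IsLeast {θ : GEX E | θ ∈ SigmaSim sim ∧ θ e = e} (hull sim e) := by
  have hex : ∃ θ, IsLeast {θ : GEX E | θ ∈ SigmaSim sim ∧ θ e = e} θ := by
    have hs := hE.isDER.toIsSKCongruence
    obtain ⟨θ, hθ, he, h0⟩ := exists_hull hE.isDER hE.dedekindOrthocomplete e
    refine ⟨θ, ⟨hθ, he⟩, ?_⟩
    rintro ξ ⟨hξ, hξe⟩
    rw [le_iff]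
    intro x hx
    -- The part of `x` outside `ξ` is fixed by `θ`, yet it is unrelated to `e` and so killed by `θ`.
    rw [← compl_apply_eq_zero_iff, ← θ.map_of_le ((ξᶜ).decr x) hx]
    exact h0 _ (not_related_of_map hξ hξe (ξ.map_compl x))
  rw [hull, dif_pos hex]
  exact hex.choose_spec

theorem hull_mem (e : E) : hull sim e ∈ SigmaSim sim := (isLeast_hull hE e).1.1

theorem hull_self (e : E) : hull sim e e = e := (isLeast_hull hE e).1.2

theorem hull_le {e : E} {θ : GEX E} (hθ : θ ∈ SigmaSim sim) (he : θ e = e) : hull sim e ≤ θ :=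
  (isLeast_hull hE e).2 ⟨hθ, he⟩

theorem hull_le_hull_iff {e f : E} : hull sim e ≤ hull sim f ↔ hull sim f e = e :=
  ⟨fun h => le_iff.1 h e (hull_self hE e), hull_le hE (hull_mem hE f)⟩

theorem hull_apply_eq_zero_iff {e f : E} : hull sim e f = 0 ↔ ¬ Related sim e f := by
  have hs := hE.isDER.toIsSKCongruence
  constructor
  · exact not_related_of_map (hull_mem hE e) (hull_self hE e)
  · intro h
    obtain ⟨θ, hθ, he, hf⟩ := (not_related_iff hE.isDER).1 h
    have h1 := le_iff.1 (hull_le hE hθ he) _ ((hull sim e).idem f)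
    rw [← h1, map_comm, hf, GEX.map_zero]

/-- For the nontrivial inequality, let `y` be the part of `x` outside the hull of `θ e`. A
subelement of `e` equivalent to a piece of `y` lies in `θ(E)`, hence below `θ e`, which is excluded.
So `y` is unrelated to `e` while lying in its hull. -/
theorem hull_map {θ : GEX E} (hθ : θ ∈ SigmaSim sim) (e : E) :
    hull sim (θ e) = θ ⊓ hull sim e := by
  have hs := hE.isDER.toIsSKCongruence
  refine le_antisymm (hull_le hE (inf_mem_SigmaSim hs hθ (hull_mem hE e)) ?_) ?_
  · rw [inf_apply, map_comm (hull sim e), hull_self hE, θ.idem]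
  · rw [le_iff]
    intro x hx
    have h1 : θ x = x := le_iff.1 (inf_le_left : θ ⊓ hull sim e ≤ θ) x hx
    have h2 : hull sim e x = x := le_iff.1 (inf_le_right : θ ⊓ hull sim e ≤ _) x hx
    rw [← compl_apply_eq_zero_iff]
    have hyx := ((hull sim (θ e))ᶜ).decr x
    rw [← (hull sim e).map_of_le hyx h2, hull_apply_eq_zero_iff hE]
    rintro ⟨a, b, ha, hb, hae, hab, hby⟩
    have hθb := θ.map_of_le (hby.trans hyx) h1
    have hθa := map_eq_self_of_sim hs hθ (hs.equivalence.symm hab) hθb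
    refine (hull_apply_eq_zero_iff hE).1 ((hull sim (θ e)).map_compl x)
      ⟨a, b, ha, hb, ?_, hab, hby⟩
    rw [← hθa]
    exact θ.mono hae

theorem eq_zero_of_hull_eq_bot {e : E} (h : hull sim e = ⊥) : e = 0 := by
  rw [← hull_self hE e, h, bot_apply]

/-- This describes the hull by relatedness alone, which is what allows faithfulness to be compared
between `E` and a summand. -/
theorem hull_eq_iff {e : E} {θ : GEX E} (hθ : θ ∈ SigmaSim sim) :
    hull sim e = θ ↔ θ e = e ∧ ∀ f, θ f = f → ¬ Related sim e f → f = 0 := by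
  constructor
  · rintro rfl
    refine ⟨hull_self hE e, fun f hf h => ?_⟩
    rw [← hf, (hull_apply_eq_zero_iff hE).2 h]
  · rintro ⟨he, h⟩
    refine le_antisymm (hull_le hE hθ he) (le_iff.2 fun x hx => ?_)
    rw [← compl_apply_eq_zero_iff]
    refine h _ (θ.map_of_le (GEX.decr _ _) hx) ?_
    rw [← hull_apply_eq_zero_iff hE, GEX.map_compl]

section Families

variable {I : Type u} {e : I → E} {s : E}
  (hdisj : ∀ i j, i ≠ j → hull sim (e i) ⊓ hull sim (e j) = ⊥) (h : HasOSum e s)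
include h

theorem eq_zero_of_forall_hull_apply {g : E} (hgs : g ≤ s) (hg : ∀ i, hull sim (e i) g = 0) :
    g = 0 :=
  eq_zero_of_le_hasOSum hE.isDER h hgs fun i hr =>
    (hull_apply_eq_zero_iff hE).1 (hg i) (hr.symm hE.isDER.toIsSKCongruence)

theorem exists_hull_apply_ne_zero {x : E} (hx : hull sim s x = x) (hx0 : x ≠ 0) :
    ∃ i, hull sim (e i) x ≠ 0 := by
  by_contra! hall
  refine hx0 ?_
  rw [← hx, hull_apply_eq_zero_iff hE]
  intro hr
  refine not_related_hasOSum hE.isDER h (fun i hr' => ?_) (hr.symm hE.isDER.toIsSKCongruence)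
  exact (hull_apply_eq_zero_iff hE).1 (hall i) (hr'.symm hE.isDER.toIsSKCongruence)

include hdisj

/-- The hull of `e i` preserves the orthosum and kills all other members, so the members are
recovered from `s` as its components. -/
theorem hull_apply_hasOSum (i : I) : hull sim (e i) s = e i := by
  have h1 := ((hull sim (e i)).map_hasOSum h).eq_of_forall_ne (i := i) fun j hj => by
    have h2 := DFunLike.congr_fun (hdisj i j hj.symm) (e j)
    rwa [inf_apply, hull_self hE] at h2
  rwa [hull_self hE] at h1

end Families

/-- Take `p` to be the orthosum of a maximal set of elements satisfying `P` with pairwise disjoint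
hulls. It exists by central orthocompleteness. -/
theorem exists_forall_hull_apply (P : E → Prop)
    (hθ : ∀ θ ∈ SigmaSim sim, ∀ p, P p → P (θ p))
    (hsum : ∀ (I : Type u) (e : I → E) (s : E), (∀ i, P (e i)) →
      (∀ i j, i ≠ j → hull sim (e i) ⊓ hull sim (e j) = ⊥) → HasOSum e s → P s) :
    ∃ p, P p ∧ ∀ q, P q → hull sim p q = q := by
  obtain ⟨T, hT⟩ := zorn_subset {T : Set E | (∀ t ∈ T, P t) ∧
      T.Pairwise fun a b => hull sim a ⊓ hull sim b = ⊥} (by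
    intro c hc hchain
    refine ⟨⋃₀ c, ⟨?_, ?_⟩, fun s hs => Set.subset_sUnion_of_mem hs⟩
    · rintro t ⟨s, hs, hts⟩
      exact (hc hs).1 t hts
    · exact (Set.pairwise_sUnion hchain.directedOn).2 fun s hs => (hc hs).2)
  obtain ⟨hT1, hT2⟩ := hT.prop
  have hdisj : ∀ i j : T, i ≠ j → hull sim i.1 ⊓ hull sim j.1 = ⊥ := fun i j hij =>
    hT2 i.2 j.2 fun h => hij (Subtype.ext h)
  obtain ⟨p, hp⟩ := hE.centrallyOrthocomplete.co1 T (fun t => t.1)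
    ⟨fun t => hull sim t.1, hdisj, fun t => hull_self hE t.1⟩
  refine ⟨p, hsum T _ p (fun t => hT1 t.1 t.2) hdisj hp, fun q hq => ?_⟩
  rw [← compl_apply_eq_zero_iff]
  have hcompl := compl_mem_SigmaSim hE.isDER.toIsSKCongruence (hull_mem hE p)
  -- The part of `q` outside the hull of `p` has a hull disjoint from those of all members of `T`,
  -- so maximality already puts it in `T`. It is then below `p`, both fixed and killed by the hull
  -- of `p`, hence zero.
  have hmem : (hull sim p)ᶜ q ∈ T := by
    refine hT.le_of_ge (y := insert ((hull sim p)ᶜ q) T) ⟨?_, ?_⟩ (Set.subset_insert _ _)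
      (Set.mem_insert _ _)
    · rintro t (rfl | ht)
      · exact hθ _ hcompl q hq
      · exact hT1 t ht
    · refine Set.pairwise_insert.2 ⟨hT2, fun t ht _ => ?_⟩
      have h1 : hull sim t ≤ hull sim p := (hull_le_hull_iff hE).2
        ((hull sim p).map_of_le (hp.le ⟨t, ht⟩) (hull_self hE p))
      have h2 : hull sim ((hull sim p)ᶜ q) ≤ (hull sim p)ᶜ := hull_le hE hcompl (GEX.idem _ _)
      have h3 : hull sim ((hull sim p)ᶜ q) ⊓ hull sim t = ⊥ :=
        le_bot_iff.1 ((inf_le_inf h2 h1).trans (le_compl_iff.1 le_rfl).le)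
      exact ⟨h3, inf_comm (hull sim t) _ ▸ h3⟩
  have h3 := (hull sim p).map_of_le (hp.le ⟨_, hmem⟩) (hull_self hE p)
  exact h3.symm.trans ((hull sim p).map_compl q)

end Hull

theorem IsSimpleElt.map {k : E} (hk : IsSimpleElt sim k) (θ : GEX E) : IsSimpleElt sim (θ k) := by
  intro e d hed hr
  obtain ⟨c, hc, hec⟩ := assoc' hed (θ.osum_compl k)
  exact hk e c hec (hr.mono le_rfl (osum_le_left hc))

/-! ### Simple, finite and invariant elements -/

section Kinds

variable (hE : IsDGEA sim)
include hE

/-- Equivalent pieces of complementary parts of `s` stay equivalent in each component, where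
simplicity of `e i` kills them; an element below `s` with all components zero is zero. -/
theorem IsSimpleElt.hasOSum {I : Type u} {e : I → E} {s : E} (he : ∀ i, IsSimpleElt sim (e i))
    (hdisj : ∀ i j, i ≠ j → hull sim (e i) ⊓ hull sim (e j) = ⊥) (h : HasOSum e s) :
    IsSimpleElt sim s := by
  rintro a d had ⟨a₁, d₁, ha, -, ha₁, hsim, hd₁⟩
  have hs := hE.isDER.toIsSKCongruence
  refine ha (eq_zero_of_forall_hull_apply hE h (ha₁.trans (osum_le_left had)) fun i => ?_)
  by_contra hi
  have h1 := (hull sim (e i)).map_osum had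
  rw [hull_apply_hasOSum hE hdisj h i] at h1
  exact he i _ _ h1 ((hs.related_of_sim (sim_map hs (hull_mem hE (e i)) hsim) hi).mono
    (GEX.mono _ ha₁) (GEX.mono _ hd₁))

/-- Adding the complementary part of `f` to `e` yields a subelement of `f` equivalent to `f`;
finiteness of `f` and cancellation conclude. -/
theorem IsFiniteElt.map {f : E} (hf : IsFiniteElt sim f) (θ : GEX E) :
    IsFiniteElt sim (θ f) := by
  have hs := hE.isDER.toIsSKCongruence
  intro e he hsim
  obtain ⟨s, hes⟩ := perp_of_le he ⟨f, θ.osum_compl f⟩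
  have h1 := hf s (osum_mono he (θ.osum_compl f) hes)
    (hs.osum hes (θ.osum_compl f) hsim (hs.equivalence.refl _))
  subst h1
  exact cancel (comm hes) (comm (θ.osum_compl s))

theorem IsFiniteElt.hasOSum {I : Type u} {e : I → E} {s : E} (he : ∀ i, IsFiniteElt sim (e i))
    (hdisj : ∀ i j, i ≠ j → hull sim (e i) ⊓ hull sim (e j) = ⊥) (h : HasOSum e s) :
    IsFiniteElt sim s := by
  have hs := hE.isDER.toIsSKCongruence
  rintro a ⟨d, had⟩ hsim
  have hd0 : d = 0 := by
    refine eq_zero_of_forall_hull_apply hE h (osum_le_right had) fun i => ?_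
    have h1 := (hull sim (e i)).map_osum had
    have h2 := sim_map hs (hull_mem hE (e i)) hsim
    rw [hull_apply_hasOSum hE hdisj h i] at h1 h2
    have h3 := he i _ (osum_le_left h1) h2
    rw [h3] at h1
    exact eq_zero_of_osum_self h1
  subst hd0
  exact unique (osum_zero a) had

/-- An invariant element is the top of its hull's summand. If `x` there were not below `c`, `sk4b`
would give a nonzero `d ⊥ c` in the summand; being related to `c`, it would violate invariance.
Conversely, an `f ⊥ c` equivalent to a subelement of `c` lies in the summand, so `f ⊕ c ≤ c` and `f
= 0`. -/
theorem isInvariantElt_iff {c : E} :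
    IsInvariantElt sim c ↔ ∀ x, hull sim c x = x → x ≤ c := by
  have hs := hE.isDER.toIsSKCongruence
  constructor
  · rintro ⟨-, hc⟩ x hx
    by_contra hxc
    obtain ⟨e, d, -, hd, hex, hsim, hdc⟩ := hE.isDER.sk4b x c hxc
    have he := GEX.map_of_le _ hex hx
    have hd' := map_eq_self_of_sim hs (hull_mem hE c) hsim he
    have hr : Related sim c d := by
      by_contra hr
      exact hd (by rw [← hd', (hull_apply_eq_zero_iff hE).2 hr])
    obtain ⟨a, b, ha, -, hac, hab, hbd⟩ := hr
    exact ha (hc a b hac hab (perp_of_le hbd hdc)).1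
  · intro h
    have hself := hull_self hE c
    refine ⟨fun e f s he hf hs => h s ?_, fun e f he hef hfc => ?_⟩
    · have h1 := (hull sim c).map_osum hs
      rw [GEX.map_of_le _ he hself, GEX.map_of_le _ hf hself] at h1
      exact unique h1 hs
    · have hf := map_eq_self_of_sim hs (hull_mem hE c) hef (GEX.map_of_le _ he hself)
      obtain ⟨s, hfs⟩ := hfc
      have h1 := (hull sim c).map_osum hfs
      rw [hf, hself] at h1
      have h2 : c = s := le_antisymm (osum_le_right hfs) (h s (unique h1 hfs))
      subst h2
      have hf0 := eq_zero_of_osum_self (comm hfs)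
      exact ⟨hs.eq_zero_left hef hf0, hf0⟩

theorem IsInvariantElt.map {c : E} (hc : IsInvariantElt sim c) {θ : GEX E}
    (hθ : θ ∈ SigmaSim sim) : IsInvariantElt sim (θ c) := by
  rw [isInvariantElt_iff hE] at hc ⊢
  intro x hx
  rw [hull_map hE hθ] at hx
  have h1 : θ x = x := le_iff.1 (inf_le_left : θ ⊓ hull sim c ≤ θ) x hx
  have h2 := hc x (le_iff.1 (inf_le_right : θ ⊓ hull sim c ≤ _) x hx)
  rw [← h1]
  exact θ.mono h2

/-- A failure produces, by `sk4b`, a nonzero `d ⊥ s` in the hull of `s`, and some component of `d`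
is nonzero. That component is orthogonal to `e i`, the top of its summand, which is impossible. -/
theorem IsInvariantElt.hasOSum {I : Type u} {e : I → E} {s : E}
    (he : ∀ i, IsInvariantElt sim (e i))
    (hdisj : ∀ i j, i ≠ j → hull sim (e i) ⊓ hull sim (e j) = ⊥) (h : HasOSum e s) :
    IsInvariantElt sim s := by
  have hs := hE.isDER.toIsSKCongruence
  rw [isInvariantElt_iff hE]
  intro x hx
  by_contra hxs
  obtain ⟨a, d, -, hd, hax, hsim, t, ht⟩ := hE.isDER.sk4b x s hxs
  have hd' := map_eq_self_of_sim hs (hull_mem hE s) hsim (GEX.map_of_le _ hax hx)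
  obtain ⟨i, hi⟩ := exists_hull_apply_ne_zero hE h hd' hd
  have h1 := (hull sim (e i)).map_osum ht
  rw [hull_apply_hasOSum hE hdisj h i] at h1
  have h2 := (isInvariantElt_iff hE).1 (he i) _ (GEX.idem _ t)
  rw [le_antisymm h2 (osum_le_right h1)] at h1
  exact hi (eq_zero_of_osum_self (comm h1))

theorem supGEX_eq {S : Set E} {p : E} (hp : p ∈ S) (h : ∀ q ∈ S, hull sim p q = q) :
    IsLUB (hull sim '' S) (supGEX (hull sim '' S)) ∧ supGEX (hull sim '' S) = hull sim p := by
  have h1 : IsLUB (hull sim '' S) (hull sim p) := by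
    refine IsGreatest.isLUB ⟨Set.mem_image_of_mem _ hp, ?_⟩
    rintro _ ⟨q, hq, rfl⟩
    exact (hull_le_hull_iff hE).2 (h q hq)
  have h2 : IsLUB (hull sim '' S) (supGEX (hull sim '' S)) := by
    rw [supGEX, dif_pos ⟨_, h1⟩]
    exact Exists.choose_spec (⟨_, h1⟩ : ∃ θ, IsLUB (hull sim '' S) θ)
  exact ⟨h2, h2.unique h1⟩

theorem exists_etaK : ∃ k, IsSimpleElt sim k ∧ (∀ q, IsSimpleElt sim q → hull sim k q = q) ∧
    IsLUB (hull sim '' {k | IsSimpleElt sim k}) (etaK sim) ∧ etaK sim = hull sim k := by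
  obtain ⟨k, hk, h⟩ := exists_forall_hull_apply hE (IsSimpleElt sim)
    (fun θ _ p hp => hp.map θ) fun I e s h1 h2 h3 => IsSimpleElt.hasOSum hE h1 h2 h3
  exact ⟨k, hk, h, supGEX_eq hE hk h⟩

theorem exists_etaF : ∃ f, IsFiniteElt sim f ∧ (∀ q, IsFiniteElt sim q → hull sim f q = q) ∧
    IsLUB (hull sim '' {f | IsFiniteElt sim f}) (etaF sim) ∧ etaF sim = hull sim f := by
  obtain ⟨k, hk, h⟩ := exists_forall_hull_apply hE (IsFiniteElt sim)
    (fun θ _ p hp => hp.map hE θ) fun I e s h1 h2 h3 => IsFiniteElt.hasOSum hE h1 h2 h3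
  exact ⟨k, hk, h, supGEX_eq hE hk h⟩

theorem isGreatest_fTilde :
    IsGreatest {c : E | IsFiniteElt sim c ∧ IsInvariantElt sim c} (fTilde sim) := by
  have hex : ∃ c, IsGreatest {c : E | IsFiniteElt sim c ∧ IsInvariantElt sim c} c := by
    obtain ⟨c, hc, h⟩ := exists_forall_hull_apply hE
      (fun c => IsFiniteElt sim c ∧ IsInvariantElt sim c)
      (fun θ hθ p hp => ⟨hp.1.map hE θ, hp.2.map hE hθ⟩)
      fun I e s h1 h2 h3 => ⟨IsFiniteElt.hasOSum hE (fun i => (h1 i).1) h2 h3,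
        IsInvariantElt.hasOSum hE (fun i => (h1 i).2) h2 h3⟩
    -- Invariance upgrades dominance of hulls to `q ≤ c`.
    exact ⟨c, hc, fun q hq => (isInvariantElt_iff hE).1 hc.2 q (h q hq)⟩
  rw [fTilde, dif_pos hex]
  exact hex.choose_spec

end Kinds

end DGEA

/-! ### Orthosums and exocentral mappings in a summand -/

namespace GEX

open GEA

variable {E : Type u} [GEA E] {π : GEX E}

theorem Summand.le_iff {x y : π.Summand} : x ≤ y ↔ x.1 ≤ y.1 := by
  constructor
  · rintro ⟨d, hd⟩
    exact ⟨d.1, hd⟩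
  · rintro ⟨d, hd⟩
    exact ⟨⟨d, mem_range_iff.2 (π.map_of_le (osum_le_right hd) (π.map_val y))⟩, hd⟩

theorem Summand.perp_iff {x y : π.Summand} : Perp x y ↔ Perp x.1 y.1 := by
  constructor
  · rintro ⟨s, hs⟩
    exact ⟨s.1, hs⟩
  · rintro ⟨s, hs⟩
    have h := π.map_osum hs
    rw [map_val, map_val] at h
    exact ⟨⟨s, mem_range_iff.2 (unique h hs)⟩, hs⟩

variable {I : Type u} {e : I → π.Summand}

theorem Summand.finOSum_val {J : Finset I} {s : π.Summand} (h : FinOSum e J s) :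
    FinOSum (fun i => (e i).1) J s.1 := by
  induction h with
  | empty => exact FinOSum.empty
  | cons hi _ h ih => exact FinOSum.cons hi ih h

theorem Summand.exists_finOSum {J : Finset I} {t : E} (h : FinOSum (fun i => (e i).1) J t) :
    ∃ s : π.Summand, s.1 = t ∧ FinOSum e J s := by
  induction h with
  | empty => exact ⟨0, rfl, FinOSum.empty⟩
  | @cons i J hi s t _ h ih =>
    obtain ⟨s', rfl, hs'⟩ := ih
    obtain ⟨t', ht'⟩ := Summand.perp_iff.2 ⟨t, h⟩
    exact ⟨t', unique (show OSum s'.1 (e i).1 t'.1 from ht') h, FinOSum.cons hi hs' ht'⟩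

theorem Summand.orthogonal_iff : Orthogonal e ↔ Orthogonal fun i => (e i).1 := by
  constructor
  · intro h J
    obtain ⟨s, hs⟩ := h J
    exact ⟨s.1, Summand.finOSum_val hs⟩
  · intro h J
    obtain ⟨s, hs⟩ := h J
    obtain ⟨t, -, ht⟩ := Summand.exists_finOSum hs
    exact ⟨t, ht⟩

theorem Summand.hasOSum_iff {s : π.Summand} :
    HasOSum e s ↔ HasOSum (fun i => (e i).1) s.1 := by
  constructor
  · rintro ⟨h1, h2, h3⟩
    refine ⟨Summand.orthogonal_iff.1 h1, ?_, fun u hu => ?_⟩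
    · rintro t ⟨J, hJ⟩
      obtain ⟨t, rfl, ht⟩ := Summand.exists_finOSum hJ
      exact Summand.le_iff.1 (h2 ⟨J, ht⟩)
    · have h : s ≤ ⟨π u, u, rfl⟩ := by
        refine h3 ?_
        rintro t ⟨J, hJ⟩
        have h4 := π.mono (hu ⟨J, Summand.finOSum_val hJ⟩)
        rw [map_val] at h4
        exact Summand.le_iff.2 h4
      exact (Summand.le_iff.1 h).trans (π.decr u)
  · rintro ⟨h1, h2, h3⟩
    refine ⟨Summand.orthogonal_iff.2 h1, ?_, fun u hu => ?_⟩
    · rintro t ⟨J, hJ⟩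
      exact Summand.le_iff.2 (h2 ⟨J, Summand.finOSum_val hJ⟩)
    · refine Summand.le_iff.2 (h3 ?_)
      rintro t ⟨J, hJ⟩
      obtain ⟨t, rfl, ht⟩ := Summand.exists_finOSum hJ
      exact Summand.le_iff.1 (hu ⟨J, ht⟩)

/-- Since `π` preserves orthosums and fixes every member, it fixes the orthosum computed in `E`. -/
theorem Summand.exists_hasOSum {s : E} (h : HasOSum (fun i => (e i).1) s) :
    ∃ t : π.Summand, t.1 = s ∧ HasOSum e t := by
  have hs : π s = s := by
    have h1 := π.map_hasOSum h
    simp only [map_val] at h1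
    exact h1.2.unique h.2
  exact ⟨⟨s, mem_range_iff.2 hs⟩, rfl, Summand.hasOSum_iff.2 h⟩

/-- The corestriction of `π` to `π(E)`. -/
def toSummand (π : GEX E) (x : E) : π.Summand := ⟨π x, x, rfl⟩

theorem toSummand_val (x : π.Summand) : π.toSummand x.1 = x := Subtype.ext (π.map_val x)

theorem toSummand_osum {x y z : E} (h : OSum x y z) :
    OSum (π.toSummand x) (π.toSummand y) (π.toSummand z) := π.map_osum h

/-- The extension of a mapping in the exocenter of `π(E)` to `E`. -/
def extend (π : GEX E) (ξ : GEX π.Summand) : GEX E where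
  toFun x := (ξ (π.toSummand x)).1
  map_osum' h := ξ.map_osum (toSummand_osum h)
  idem' x := by rw [toSummand_val, ξ.idem]
  decr' x := (Summand.le_iff.1 (ξ.decr (π.toSummand x))).trans (π.decr x)
  orth' := by
    intro e f he hf
    have hπe : π e = e := by
      rw [← he]
      exact π.map_val _
    obtain ⟨r, hr⟩ := ξ.orth (e := π.toSummand e) (f := π.toSummand f)
      (Subtype.ext (he.trans hπe.symm)) (Subtype.ext hf)
    have hr' : OSum (π e) (π f) r.1 := hr
    rw [hπe] at hr'
    obtain ⟨t, ht⟩ := π.orth (π.map_val r) (π.map_compl f)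
    obtain ⟨s, hs, hst⟩ := assoc' hr' ht
    rw [unique hs (π.osum_compl f)] at hst
    exact ⟨t, hst⟩

theorem extend_val (ξ : GEX π.Summand) (x : π.Summand) : π.extend ξ x.1 = (ξ x).1 :=
  congrArg (fun y => (ξ y).1) (toSummand_val x)

/-- The restriction of a mapping in the exocenter of `E` to `π(E)`. -/
def restrictGEX (π ξ : GEX E) : GEX π.Summand where
  toFun x := ⟨ξ x.1, mem_range_iff.2 (π.map_of_le (ξ.decr _) (π.map_val x))⟩
  map_osum' h := ξ.map_osum h
  idem' x := Subtype.ext (ξ.idem x.1)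
  decr' x := Summand.le_iff.2 (ξ.decr x.1)
  orth' he hf := Summand.perp_iff.2 (ξ.orth (congrArg Subtype.val he) (congrArg Subtype.val hf))

end GEX

/-! ### Passing structure and element kinds to a summand -/

namespace DGEA

open GEA GEX

variable {E : Type u} [GEA E] {sim : E → E → Prop} {π : GEX E}

/-- Precomposing the witnessing mappings with `π` extends them to `E` without losing disjointness.
-/
theorem GEXOrthogonal.val {I : Type u} {e : I → π.Summand} (h : GEXOrthogonal e) :
    GEXOrthogonal fun i => (e i).1 := by
  obtain ⟨ξ, hξ, he⟩ := h
  refine ⟨fun i => π.extend (ξ i), fun i j hij => ext_apply fun x => ?_, fun i => ?_⟩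
  · exact (extend_val (ξ i) (ξ j (π.toSummand x))).trans
      (congrArg Subtype.val (DFunLike.congr_fun (hξ i j hij) (π.toSummand x)))
  · exact (extend_val (ξ i) (e i)).trans (congrArg Subtype.val (he i))

theorem related_restrict_iff {x y : π.Summand} :
    Related (π.restrict sim) x y ↔ Related sim x.1 y.1 := by
  constructor
  · rintro ⟨a, b, ha, hb, hax, hab, hby⟩
    exact ⟨a.1, b.1, fun h => ha (Subtype.ext h), fun h => hb (Subtype.ext h),
      Summand.le_iff.1 hax, hab, Summand.le_iff.1 hby⟩
  · rintro ⟨a, b, ha, hb, hax, hab, hby⟩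
    exact ⟨⟨a, mem_range_iff.2 (π.map_of_le hax (π.map_val x))⟩,
      ⟨b, mem_range_iff.2 (π.map_of_le hby (π.map_val y))⟩,
      fun h => ha (congrArg Subtype.val h), fun h => hb (congrArg Subtype.val h),
      Summand.le_iff.2 hax, hab, Summand.le_iff.2 hby⟩

theorem CentrallyOrthocomplete.restrict (hE : CentrallyOrthocomplete E) (π : GEX E) :
    CentrallyOrthocomplete π.Summand where
  co1 I e he := by
    obtain ⟨s, hs⟩ := hE.co1 I _ he.val
    obtain ⟨t, -, ht⟩ := Summand.exists_hasOSum hs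
    exact ⟨t, ht⟩
  co2 I e s x he hs hx := Summand.perp_iff.2 (hE.co2 I _ s.1 x.1 he.val (Summand.hasOSum_iff.1 hs)
    fun i => Summand.perp_iff.1 (hx i))

theorem dedekindOrthocomplete_restrict (hE : DedekindOrthocomplete E) (π : GEX E) :
    DedekindOrthocomplete π.Summand := by
  rintro I e he ⟨u, hu⟩
  obtain ⟨s, hs⟩ := hE I _ (Summand.orthogonal_iff.1 he) ⟨u.1, by
    rintro t ⟨J, hJ⟩
    obtain ⟨t, rfl, ht⟩ := Summand.exists_finOSum hJ
    exact Summand.le_iff.1 (hu ⟨J, ht⟩)⟩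
  obtain ⟨t, -, ht⟩ := Summand.exists_hasOSum hs
  exact ⟨t, ht⟩

theorem restrictGEX_mem_SigmaSim {θ : GEX E} (hθ : θ ∈ SigmaSim sim) :
    π.restrictGEX θ ∈ SigmaSim (π.restrict sim) := by
  rw [mem_SigmaSim_iff] at hθ ⊢
  intro x y hx hy hxy
  have h := hθ x.1 y.1 (congrArg Subtype.val hx) (congrArg Subtype.val hy) hxy
  exact ⟨Subtype.ext h.1, Subtype.ext h.2⟩

/-- Witnesses that are subelements stay in `π(E)` automatically; those known only up to equivalence
stay there because `π` splits the relation. -/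
theorem IsDER.restrict (hd : IsDER sim) (hπ : π ∈ SigmaSim sim) : IsDER (π.restrict sim) where
  equivalence := hd.equivalence.comap _
  sk1 e h := Subtype.ext (hd.sk1 e.1 h)
  sk2 I e f s t he hf h := hd.sk2 I _ _ s.1 t.1 (Summand.hasOSum_iff.1 he)
    (Summand.hasOSum_iff.1 hf) h
  sk3d p s t q h hpq := by
    obtain ⟨e, f, hef, he, hf⟩ := hd.sk3d p.1 s.1 t.1 q.1 h hpq
    exact ⟨⟨e, mem_range_iff.2 (π.map_of_le (osum_le_left hef) (π.map_val p))⟩,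
      ⟨f, mem_range_iff.2 (π.map_of_le (osum_le_right hef) (π.map_val p))⟩, hef, he, hf⟩
  sk3e e f s t q h1 h2 := by
    obtain ⟨e₁, e₂, f₁, f₂, a, b, he, hf, ha, hsa, hb, htb⟩ := hd.sk3e e.1 f.1 s.1 t.1 q.1 h1 h2
    exact ⟨⟨e₁, mem_range_iff.2 (π.map_of_le (osum_le_left he) (π.map_val e))⟩,
      ⟨e₂, mem_range_iff.2 (π.map_of_le (osum_le_right he) (π.map_val e))⟩,
      ⟨f₁, mem_range_iff.2 (π.map_of_le (osum_le_left hf) (π.map_val f))⟩,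
      ⟨f₂, mem_range_iff.2 (π.map_of_le (osum_le_right hf) (π.map_val f))⟩,
      ⟨a, mem_range_iff.2 (map_eq_self_of_sim hd.toIsSKCongruence hπ hsa (π.map_val s))⟩,
      ⟨b, mem_range_iff.2 (map_eq_self_of_sim hd.toIsSKCongruence hπ htb (π.map_val t))⟩,
      he, hf, ha, hsa, hb, htb⟩
  sk4a e f h := related_restrict_iff.2 (hd.sk4a e.1 f.1 fun h' => h (Summand.perp_iff.2 h'))
  sk4b e f h := by
    obtain ⟨e₁, d₁, he, hd₁, hle, hsim, hperp⟩ :=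
      hd.sk4b e.1 f.1 fun h' => h (Summand.le_iff.2 h')
    have he₁ := π.map_of_le hle (π.map_val e)
    exact ⟨⟨e₁, mem_range_iff.2 he₁⟩,
      ⟨d₁, mem_range_iff.2 (map_eq_self_of_sim hd.toIsSKCongruence hπ hsim he₁)⟩,
      fun h => he (congrArg Subtype.val h), fun h => hd₁ (congrArg Subtype.val h),
      Summand.le_iff.2 hle, hsim, Summand.perp_iff.2 hperp⟩
  sk4a' e f h := by
    rw [related_restrict_iff, not_related_iff hd] at h
    obtain ⟨θ, hθ, he, hf⟩ := h
    exact ⟨π.restrictGEX θ, restrictGEX_mem_SigmaSim hθ, mem_range_iff.2 (Subtype.ext he),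
      mem_range_compl_iff.2 (Subtype.ext hf)⟩

theorem IsDGEA.restrict (hE : IsDGEA sim) (hπ : π ∈ SigmaSim sim) : IsDGEA (π.restrict sim) where
  centrallyOrthocomplete := hE.centrallyOrthocomplete.restrict π
  dedekindOrthocomplete := dedekindOrthocomplete_restrict hE.dedekindOrthocomplete π
  isDER := hE.isDER.restrict hπ

theorem isSimpleElt_restrict_iff {k : π.Summand} :
    IsSimpleElt (π.restrict sim) k ↔ IsSimpleElt sim k.1 := by
  constructor
  · intro h e d hed hr
    exact h ⟨e, mem_range_iff.2 (π.map_of_le (osum_le_left hed) (π.map_val k))⟩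
      ⟨d, mem_range_iff.2 (π.map_of_le (osum_le_right hed) (π.map_val k))⟩ hed
      (related_restrict_iff.2 hr)
  · intro h e d hed hr
    exact h e.1 d.1 hed (related_restrict_iff.1 hr)

theorem isFiniteElt_restrict_iff {f : π.Summand} :
    IsFiniteElt (π.restrict sim) f ↔ IsFiniteElt sim f.1 := by
  constructor
  · intro h e hef hsim
    exact congrArg Subtype.val (h ⟨e, mem_range_iff.2 (π.map_of_le hef (π.map_val f))⟩
      (Summand.le_iff.2 hef) hsim)
  · intro h e hef hsim
    exact Subtype.ext (h e.1 (Summand.le_iff.1 hef) hsim)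

theorem isInvariantElt_restrict_iff (hs : IsSKCongruence sim) (hπ : π ∈ SigmaSim sim)
    {c : π.Summand} : IsInvariantElt (π.restrict sim) c ↔ IsInvariantElt sim c.1 := by
  constructor
  · rintro ⟨hp, hc⟩
    refine ⟨fun e f s he hf h => ?_, fun e f he hef hfc => ?_⟩
    · let e' : π.Summand := ⟨e, mem_range_iff.2 (π.map_of_le he (π.map_val c))⟩
      let f' : π.Summand := ⟨f, mem_range_iff.2 (π.map_of_le hf (π.map_val c))⟩
      obtain ⟨s', hs'⟩ : Perp e' f' := Summand.perp_iff.2 ⟨s, h⟩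
      have h1 := Summand.le_iff.1 (hp e' f' s' (Summand.le_iff.2 he) (Summand.le_iff.2 hf) hs')
      rwa [unique (show OSum e f s'.1 from hs') h] at h1
    · have he' := π.map_of_le he (π.map_val c)
      have h1 := hc ⟨e, mem_range_iff.2 he'⟩
        ⟨f, mem_range_iff.2 (map_eq_self_of_sim hs hπ hef he')⟩ (Summand.le_iff.2 he) hef
        (Summand.perp_iff.2 hfc)
      exact ⟨congrArg Subtype.val h1.1, congrArg Subtype.val h1.2⟩
  · rintro ⟨hp, hc⟩
    refine ⟨fun e f s he hf h => Summand.le_iff.2 (hp e.1 f.1 s.1 (Summand.le_iff.1 he)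
      (Summand.le_iff.1 hf) h), fun e f he hef hfc => ?_⟩
    have h1 := hc e.1 f.1 (Summand.le_iff.1 he) hef (Summand.perp_iff.1 hfc)
    exact ⟨Subtype.ext h1.1, Subtype.ext h1.2⟩

/-! ### Type criteria -/

section Types

variable (hE : IsDGEA sim) (hπ : π ∈ SigmaSim sim)
include hE hπ

theorem isFaithfulElt_restrict_iff {p : π.Summand} :
    IsFaithfulElt (π.restrict sim) p ↔ hull sim p.1 = π := by
  have hE' := hE.restrict hπ
  have htop : (⊤ : GEX π.Summand) ∈ SigmaSim (π.restrict sim) := by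
    rw [mem_SigmaSim_iff]
    intro x y _ hy hxy
    exact ⟨hE'.isDER.eq_zero_left hxy hy, hy⟩
  rw [IsFaithfulElt, hull_eq_iff hE' htop, hull_eq_iff hE hπ]
  constructor
  · rintro ⟨-, h⟩
    exact ⟨π.map_val p, fun f hf hr => congrArg Subtype.val
      (h ⟨f, mem_range_iff.2 hf⟩ rfl fun h' => hr (related_restrict_iff.1 h'))⟩
  · rintro ⟨-, h⟩
    exact ⟨rfl, fun f _ hr => Subtype.ext (h f.1 (π.map_val f)
      fun h' => hr (related_restrict_iff.2 h'))⟩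

theorem isTypeI_restrict_iff_exists :
    IsTypeI (π.restrict sim) ↔ ∃ k, IsSimpleElt sim k ∧ hull sim k = π := by
  constructor
  · rintro ⟨k, hk, hf⟩
    exact ⟨k.1, isSimpleElt_restrict_iff.1 hk, (isFaithfulElt_restrict_iff hE hπ).1 hf⟩
  · rintro ⟨k, hk, hf⟩
    exact ⟨⟨k, mem_range_iff.2 (hf ▸ hull_self hE k)⟩, isSimpleElt_restrict_iff.2 hk,
      (isFaithfulElt_restrict_iff hE hπ).2 hf⟩

theorem exists_finite_faithful_restrict_iff :
    (∃ f, IsFiniteElt (π.restrict sim) f ∧ IsFaithfulElt (π.restrict sim) f) ↔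
      ∃ f, IsFiniteElt sim f ∧ hull sim f = π := by
  constructor
  · rintro ⟨k, hk, hf⟩
    exact ⟨k.1, isFiniteElt_restrict_iff.1 hk, (isFaithfulElt_restrict_iff hE hπ).1 hf⟩
  · rintro ⟨k, hk, hf⟩
    exact ⟨⟨k, mem_range_iff.2 (hf ▸ hull_self hE k)⟩, isFiniteElt_restrict_iff.2 hk,
      (isFaithfulElt_restrict_iff hE hπ).2 hf⟩

theorem isFiniteType_restrict_iff_exists :
    IsFiniteType (π.restrict sim) ↔
      ∃ f, (IsFiniteElt sim f ∧ IsInvariantElt sim f) ∧ hull sim f = π := by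
  have hs := hE.isDER.toIsSKCongruence
  constructor
  · rintro ⟨k, hk, hi, hf⟩
    exact ⟨k.1, ⟨isFiniteElt_restrict_iff.1 hk, (isInvariantElt_restrict_iff hs hπ).1 hi⟩,
      (isFaithfulElt_restrict_iff hE hπ).1 hf⟩
  · rintro ⟨k, ⟨hk, hi⟩, hf⟩
    exact ⟨⟨k, mem_range_iff.2 (hf ▸ hull_self hE k)⟩, isFiniteElt_restrict_iff.2 hk,
      (isInvariantElt_restrict_iff hs hπ).2 hi, (isFaithfulElt_restrict_iff hE hπ).2 hf⟩

theorem inf_hull_eq_bot_iff {p : E} : π ⊓ hull sim p = ⊥ ↔ π p = 0 := by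
  constructor
  · intro h
    rw [← hull_map hE hπ] at h
    exact eq_zero_of_hull_eq_bot hE h
  · intro h
    have h1 := hull_le hE (compl_mem_SigmaSim hE.isDER.toIsSKCongruence hπ)
      (compl_apply_eq_self_iff.2 h)
    rw [inf_comm, ← le_bot_iff, ← le_compl_iff.1 h1]

variable {P : E → Prop} (hP : ∀ θ ∈ SigmaSim sim, ∀ p, P p → P (θ p)) {p : E} (hp : P p)
  (hmax : ∀ q, P q → hull sim p q = q)
include hP hp hmax

/-- If `π` is below the hull of `p`, then `π p` has `P`, and by `hull_map` its hull is all of `π`.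
-/
theorem exists_hull_eq_iff : (∃ q, P q ∧ hull sim q = π) ↔ π ∈ ThetaEta sim ∧ π ≤ hull sim p := by
  constructor
  · rintro ⟨q, hq, rfl⟩
    exact ⟨⟨q, rfl⟩, (hull_le_hull_iff hE).2 (hmax q hq)⟩
  · rintro ⟨-, h⟩
    exact ⟨π p, hP π hπ p hp, by rw [hull_map hE hπ, inf_eq_left.2 h]⟩

/-- Disjointness means `π p = 0`. The element `π p` is itself a test case, and any `q` with `P` lies
in the hull of `p`, so disjointness kills its `π`-part. -/
theorem forall_eq_zero_iff : (∀ q, P q → π q = q → q = 0) ↔ π ⊓ hull sim p = ⊥ := by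
  rw [inf_hull_eq_bot_iff hE hπ]
  constructor
  · exact fun h => h _ (hP π hπ p hp) (π.idem p)
  · intro h q hq hqπ
    have h1 := DFunLike.congr_fun ((inf_hull_eq_bot_iff hE hπ).2 h) q
    rwa [inf_apply, hmax q hq, hqπ] at h1

end Types

end DGEA

/-- The first five conjuncts say that the objects in the remaining ones are well defined: every
`η_e`, the suprema `η_K` and `η_F`, and the largest finite invariant element exist, and `π(E)` is
a dimension generalized effect algebra under the restricted relation. -/
theorem mainTheorem2 {E : Type u} [GEA E] (sim : E → E → Prop) (hE : IsDGEA sim)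
    (π : GEX E) (hπ : π ∈ SigmaSim sim) :
    (∀ e : E, IsLeast {θ : GEX E | θ ∈ SigmaSim sim ∧ θ e = e} (hull sim e)) ∧
    IsLUB (hull sim '' {k | IsSimpleElt sim k}) (etaK sim) ∧
    IsLUB (hull sim '' {f | IsFiniteElt sim f}) (etaF sim) ∧
    IsGreatest {c : E | IsFiniteElt sim c ∧ IsInvariantElt sim c} (fTilde sim) ∧
    IsDGEA (π.restrict sim) ∧
    (IsTypeI (π.restrict sim) ∨ IsTypeII (π.restrict sim) ∨ IsFiniteType (π.restrict sim) →
      π ∈ ThetaEta sim) ∧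
    (IsTypeI (π.restrict sim) ↔ π ∈ ThetaEta sim ∧ π ≤ etaK sim) ∧
    (IsTypeII (π.restrict sim) ↔ π ∈ ThetaEta sim ∧ π ≤ etaF sim ⊓ (etaK sim)ᶜ) ∧
    (IsTypeIII (π.restrict sim) ↔ π ≤ (etaF sim)ᶜ) ∧
    (IsFiniteType (π.restrict sim) ↔ π ∈ ThetaEta sim ∧ π ≤ hull sim (fTilde sim)) ∧
    (IsProperlyNonFiniteType (π.restrict sim) ↔ π ⊓ hull sim (fTilde sim) = ⊥) ∧
    (IsTypeIF (π.restrict sim) ↔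
      π ∈ ThetaEta sim ∧ π ≤ etaK sim ⊓ hull sim (fTilde sim)) ∧
    (IsTypeIIF (π.restrict sim) ↔
      π ∈ ThetaEta sim ∧ π ≤ etaF sim ⊓ (etaK sim)ᶜ ⊓ hull sim (fTilde sim)) ∧
    (IsTypeINotF (π.restrict sim) ↔
      π ∈ ThetaEta sim ∧ π ≤ etaK sim ⊓ (hull sim (fTilde sim))ᶜ) ∧
    (IsTypeIINotF (π.restrict sim) ↔
      π ∈ ThetaEta sim ∧ π ≤ etaF sim ⊓ (etaK sim)ᶜ ⊓ (hull sim (fTilde sim))ᶜ) := by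
  have hKP : ∀ θ ∈ SigmaSim sim, ∀ p, IsSimpleElt sim p → IsSimpleElt sim (θ p) :=
    fun θ _ p hp => hp.map θ
  have hFP : ∀ θ ∈ SigmaSim sim, ∀ p, IsFiniteElt sim p → IsFiniteElt sim (θ p) :=
    fun θ _ p hp => hp.map hE θ
  have hIP : ∀ θ ∈ SigmaSim sim, ∀ p, IsFiniteElt sim p ∧ IsInvariantElt sim p →
      IsFiniteElt sim (θ p) ∧ IsInvariantElt sim (θ p) :=
    fun θ hθ p hp => ⟨hp.1.map hE θ, hp.2.map hE hθ⟩
  obtain ⟨k, hk, hkmax, hKlub, hK⟩ := exists_etaK hE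
  obtain ⟨f, hf, hfmax, hFlub, hF⟩ := exists_etaF hE
  have hc := isGreatest_fTilde hE
  have hcmax : ∀ q, IsFiniteElt sim q ∧ IsInvariantElt sim q →
      hull sim (fTilde sim) q = q := fun q hq =>
    GEX.map_of_le _ (hc.2 hq) (hull_self hE _)
  have hI : IsTypeI (π.restrict sim) ↔ π ∈ ThetaEta sim ∧ π ≤ etaK sim := by
    rw [isTypeI_restrict_iff_exists hE hπ, exists_hull_eq_iff hE hπ hKP hk hkmax, hK]
  -- Absence of simple elements is disjointness from `etaK`, which in the exocenter is the same as
  -- lying below its complement.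
  have hK0 : (∀ k, IsSimpleElt (π.restrict sim) k → k = 0) ↔ π ≤ (etaK sim)ᶜ := by
    rw [GEX.le_compl_iff, hK, ← forall_eq_zero_iff hE hπ hKP hk hkmax]
    exact ⟨fun h q hq hqπ => congrArg Subtype.val
        (h ⟨q, q, hqπ⟩ (isSimpleElt_restrict_iff.2 hq)),
      fun h q hq => Subtype.ext (h q.1 (isSimpleElt_restrict_iff.1 hq) (π.map_val q))⟩
  have hII : IsTypeII (π.restrict sim) ↔ π ∈ ThetaEta sim ∧ π ≤ etaF sim ⊓ (etaK sim)ᶜ := by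
    rw [IsTypeII, hK0, exists_finite_faithful_restrict_iff hE hπ,
      exists_hull_eq_iff hE hπ hFP hf hfmax, ← hF, le_inf_iff, and_assoc]
  have hIII : IsTypeIII (π.restrict sim) ↔ π ≤ (etaF sim)ᶜ := by
    rw [GEX.le_compl_iff, hF, ← forall_eq_zero_iff hE hπ hFP hf hfmax]
    exact ⟨fun h q hq hqπ => congrArg Subtype.val
        (h ⟨q, q, hqπ⟩ (isFiniteElt_restrict_iff.2 hq)),
      fun h q hq => Subtype.ext (h q.1 (isFiniteElt_restrict_iff.1 hq) (π.map_val q))⟩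
  have hFin : IsFiniteType (π.restrict sim) ↔
      π ∈ ThetaEta sim ∧ π ≤ hull sim (fTilde sim) := by
    rw [isFiniteType_restrict_iff_exists hE hπ, exists_hull_eq_iff hE hπ hIP hc.1 hcmax]
  have hPNF : IsProperlyNonFiniteType (π.restrict sim) ↔ π ⊓ hull sim (fTilde sim) = ⊥ := by
    have hs := hE.isDER.toIsSKCongruence
    rw [← forall_eq_zero_iff hE hπ hIP hc.1 hcmax]
    exact ⟨fun h q hq hqπ => congrArg Subtype.val (h ⟨q, q, hqπ⟩
        (isFiniteElt_restrict_iff.2 hq.1) ((isInvariantElt_restrict_iff hs hπ).2 hq.2)),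
      fun h q hq hqi => Subtype.ext (h q.1 ⟨isFiniteElt_restrict_iff.1 hq,
        (isInvariantElt_restrict_iff hs hπ).1 hqi⟩ (π.map_val q))⟩
  refine ⟨isLeast_hull hE, hKlub, hFlub, hc, hE.restrict hπ, ?_, hI, hII, hIII, hFin, hPNF,
    ?_, ?_, ?_, ?_⟩
  · rintro (h | h | h)
    · exact (hI.1 h).1
    · exact (hII.1 h).1
    · exact (hFin.1 h).1
  · rw [IsTypeIF, hI, hFin, le_inf_iff, ← and_and_left]
  · rw [IsTypeIIF, hII, hFin, le_inf_iff (a := etaF sim ⊓ (etaK sim)ᶜ),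
      ← and_and_left]
  · rw [IsTypeINotF, hI, hPNF, le_inf_iff, GEX.le_compl_iff, and_assoc]
  · rw [IsTypeIINotF, hII, hPNF, le_inf_iff (a := etaF sim ⊓ (etaK sim)ᶜ),
      GEX.le_compl_iff (ξ := hull sim (fTilde sim)), and_assoc]
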